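/- Let $\triangle$ be a connected Dynkin diagram of finite type (any of $A_n,B_n,C_n,D_n,E_{6,7,8},F_4,G_2$) with vertex set $\triangle_0$, positive roots $\Phi^+$, simple roots $\alpha_i$, and Weyl group $\mathsf W$ generated by the simple reflections $s_i$ ($i\in\triangle_0$). Let $w_0$ be the longest element of $\mathsf W$, let $i\mapsto i^*$ be the map on $\triangle_0$ with $w_0\alpha_i=-\alpha_{i^*}$, and let $\mathsf h$ be the Coxeter number (the order of a Coxeter element). A *Dynkin quiver* is a pair $Q=(\triangle,\xi)$ with a height function $\xi:\triangle_0\to\mathbb Z$ satisfying $|\xi_i-\xi_j|=1$ whenever $i,j$ are joined by an edge. A vertex $i$ is a *source* of $Q$ if $\xi_i>\xi_j$ for all neighbours $j$ of $i$; in that case $s_iQ=(\triangle,s_i\xi)$ with $(s_i\xi)_j=\xi_j-2\delta_{ij}$. A reduced expression $s_{i_1}\cdots s_{i_l}$ is *$Q$-adapted* if $i_k$ is a source of $s_{i_{k-1}}\cdots s_{i_1}Q$ for all $1\le k\le l$. A *Coxeter element* is an element with a reduced expression of length $|\triangle_0|$ in which every simple reflection occurs. The *commutation class* $[\underline w]$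 of a reduced expression $\underline w$ is the set of expressions obtained from it by repeatedly exchanging neighbouring letters $s_a s_b\to s_bs_a$ with $a\ne b$ not joined by an edge. If a commutation class of $w_0$ contains a reduced expression $s_{i_1}s_{i_2}\cdots s_{i_\ell}$, put $r_{i_1}[s_{i_1}\cdots s_{i_\ell}]=[s_{i_2}\cdots s_{i_\ell}s_{i_1^*}]$; let $\overset{r}{\sim}$ be the equivalence relation on commutation classes of reduced expressions of $w_0$ generated by $c\overset r\sim r_ic$. Its equivalence classes are called *$r$-cluster points*. **Theorem.** Let $Q=(\triangle,\xi)$ be a Dynkin quiver. 1. There is a unique Coxeter element $\tau_Q\in\mathsf W$ that has a $Q$-adapted reduced expression. 2. $s_i\tau_Qs_i=\tau_{s_iQ}$ for every source $i$ of $Q$, and the order of $\tau_Q$ is $\mathsf h=\dfrac{2|\Phi^+|}{|\triangle_0|}$. 3. Every reduced expression $s_{i_1}\cdots s_{i_n}$ of $\tau_Q$ is $Q$-adapted, and the height function $\xi'$ of $s_{i_n}\cdots s_{i_1}Q$ is given by $\xi'_i=\xi_i-2$ for all $i\in\triangle_0$. 4. There is a $Q$-adapted reduced expression of $w_0$, and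 the set $[Q]$ of all $Q$-adapted reduced expressions of $w_0$ is a single commutation class. 5. If $s_{i_1}\cdots s_{i_\ell}$ is a $Q$-adapted reduced expression of $w_0$, then the height function $\xi'$ of $s_{i_\ell}\cdots s_{i_1}Q$ is given by $\xi'_i=\xi_{i^*}-\mathsf h$ for all $i\in\triangle_0$; moreover $s_{i_2}\cdots s_{i_\ell}s_{i_{\ell+1}}$ with $i_{\ell+1}=i_1^*$ is an $(s_{i_1}Q)$-adapted reduced expression of $w_0$. 6. If $Q'=(\triangle,\xi')$ is another Dynkin quiver on $\triangle$, then $[Q]\overset r\sim[Q']$; moreover, if $[Q]=[Q']$, then there is $k\in\mathbb Z$ with $\xi_i=\xi'_i+k$ for all $i\in\triangle_0$. 7. The set $\{[Q]\mid Q=(\triangle,\xi)\}$ is an $r$-cluster point, and its cardinality is $2^{|\triangle_0|-1}$. -/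

import Mathlib

/-! Root systems are Mathlib's: a reduced crystallographic irreducible root system `P` over `ℝ`
with a base `b` is the same thing as a connected Dynkin diagram of finite type together with its
realization. The vertex set of the diagram is the set `b.support` of indices of simple roots. -/

noncomputable section

namespace DynkinQuivers

open RootPairing

variable {ι M N : Type*} [AddCommGroup M] [Module ℝ M] [AddCommGroup N] [Module ℝ N]
  {P : RootPairing ι ℝ M N}

section WeylGroup

variable (b : P.Base)

/-- The simple root `α_i`. -/
def simpleRoot (i : b.support) : M := P.root i

/-- The simple reflection `s_i`, as an element of the Weyl group. -/
def s (i : b.support) : P.weylGroup := weylGroup.ofIdx P i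

/-- The product `s_{i_1} ⋯ s_{i_l}` in the Weyl group of a word `i_1 ⋯ i_l`. -/
def wordProd (w : List b.support) : P.weylGroup := (w.map (s b)).prod

/-- The length `ℓ(x)`: the least number of simple reflections with product `x`. -/
def length (x : P.weylGroup) : ℕ := sInf {k | ∃ w : List b.support, w.length = k ∧ wordProd b w = x}

/-- The word `w` is a reduced expression of `x`. -/
def IsReducedExpr (w : List b.support) (x : P.weylGroup) : Prop :=
  wordProd b w = x ∧ w.length = length b x

/-- For a root system, the Weyl group acts faithfully on the roots. -/
theorem weylGroupToPerm_injective [P.IsRootSystem] :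
    Function.Injective P.weylGroupToPerm := by
  intro g h hgh
  apply Subtype.ext
  apply Equiv.weightHom_injective P
  ext x
  have hx : x ∈ Submodule.span ℝ (Set.range P.root) := by
    rw [IsRootSystem.span_root_eq_top]; trivial
  change g • x = h • x
  induction hx using Submodule.span_induction with
  | mem y hy =>
    obtain ⟨i, rfl⟩ := hy
    rw [weylGroup_apply_root, weylGroup_apply_root, hgh]
  | zero => rw [smul_zero, smul_zero]
  | add y z _ _ hy hz => rw [smul_add, smul_add, hy, hz]
  | smul a y _ hy => rw [smul_comm g a y, smul_comm h a y, hy]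

/-- The Weyl group of a finite root system is finite. -/
theorem finite_weylGroup [Finite ι] [P.IsRootSystem] : Finite P.weylGroup :=
  Finite.of_injective _ weylGroupToPerm_injective

/-- There is an element of the Weyl group of biggest length. -/
theorem exists_longest [Finite ι] [P.IsRootSystem] :
    ∃ x : P.weylGroup, ∀ y : P.weylGroup, length b y ≤ length b x :=
  have : Finite P.weylGroup := finite_weylGroup
  Finite.exists_max (length b)

/-- The longest element `w_0` of the Weyl group. -/
def longestElement [Finite ι] [P.IsRootSystem] : P.weylGroup := (exists_longest b).choose

open scoped Classical in
/-- The map `i ↦ i^*` on vertices, determined by `w_0 α_i = -α_{i^*}`. (The second branch never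
occurs; the main theorem also asserts that `w_0 α_i = -α_{i^*}` for all `i`.) -/
def star [Finite ι] [P.IsRootSystem] (i : b.support) : b.support :=
  if h : ∃ j : b.support, longestElement b • simpleRoot b i = -simpleRoot b j then h.choose else i

/-- A Coxeter element: it has a reduced expression `s_{i_1} ⋯ s_{i_n}`, with `n` the number of
vertices, in which every vertex occurs. -/
def IsCoxeterElement (x : P.weylGroup) : Prop :=
  ∃ w : List b.support, IsReducedExpr b w x ∧ w.length = b.support.card ∧ ∀ i, i ∈ w

/-- The Coxeter number: the order of a Coxeter element, here the product of all the simple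
reflections in some chosen order (the result does not depend on that order). -/
def coxeterNumber : ℕ := orderOf (wordProd b (Finset.univ : Finset b.support).toList)

/-- The number `|Φ⁺|` of positive roots. -/
def numPosRoots : ℕ := Nat.card {i : ι // b.IsPos i}

end WeylGroup

section Dynkin

variable [Finite ι] [P.IsCrystallographic] (b : P.Base)

/-- The Dynkin diagram: `i` and `j` are joined by an edge when `c_{i,j} < 0`. -/
def dynkinGraph : SimpleGraph b.support where
  Adj i j := b.cartanMatrix i j < 0
  symm := ⟨fun i j h => by
    have hij : j ≠ i := by
      rintro rfl
      rw [b.cartanMatrix_apply_same] at h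
      omega
    refine lt_of_le_of_ne (b.cartanMatrix_le_zero_of_ne j i hij) fun h0 => ?_
    rw [b.cartanMatrix_apply_eq_zero_iff_symm] at h0
    omega⟩
  loopless := ⟨fun i h => by
    rw [b.cartanMatrix_apply_same] at h
    omega⟩

/-- One commutation move: exchange two neighbouring letters `i, k` with `d(i, k) > 1`, that is,
distinct and not joined by an edge. -/
def CommStep (w w' : List b.support) : Prop :=
  ∃ (u v : List b.support) (i k : b.support), i ≠ k ∧ ¬ (dynkinGraph b).Adj i k ∧
    w = u ++ i :: k :: v ∧ w' = u ++ k :: i :: v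

/-- The commutation class `[w]` of a word `w`. -/
def commutationClass (w : List b.support) : Set (List b.support) :=
  {w' | Relation.EqvGen (CommStep b) w w'}

/-- `c' = r_i c` for some vertex `i`: the commutation class `c` contains a reduced expression
`s_i s_{i_2} ⋯ s_{i_ℓ}` of `w_0`, and `c' = [s_{i_2} ⋯ s_{i_ℓ} s_{i^*}]`. -/
def ReflStep [P.IsRootSystem] (c c' : Set (List b.support)) : Prop :=
  ∃ (i : b.support) (w : List b.support), IsReducedExpr b (i :: w) (longestElement b) ∧
    c = commutationClass b (i :: w) ∧ c' = commutationClass b (w ++ [star b i])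

/-- Reflection equivalence of commutation classes: the equivalence relation generated by
`c ∼ r_i c`. -/
def ReflEquiv [P.IsRootSystem] (c c' : Set (List b.support)) : Prop :=
  Relation.EqvGen (ReflStep b) c c'

/-- `S` is an `r`-cluster point: the set of all commutation classes of reduced expressions of `w_0`
that are reflection equivalent to a given one. -/
def IsRClusterPoint [P.IsRootSystem] (S : Set (Set (List b.support))) : Prop :=
  ∃ w, IsReducedExpr b w (longestElement b) ∧
    S = {c | (∃ w', IsReducedExpr b w' (longestElement b) ∧ c = commutationClass b w') ∧
      ReflEquiv b c (commutationClass b w)}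

/-- A Dynkin quiver `Q = (△, ξ)`: a height function `ξ` on the Dynkin diagram. -/
structure DynkinQuiver where
  /-- The height function `ξ`. -/
  height : b.support → ℤ
  abs_sub_eq_one : ∀ i j, (dynkinGraph b).Adj i j → |height i - height j| = 1

namespace DynkinQuiver

variable {b}

/-- The vertex `i` is a source of `Q`. -/
def IsSource (Q : DynkinQuiver b) (i : b.support) : Prop :=
  ∀ j, (dynkinGraph b).Adj i j → Q.height j < Q.height i

open scoped Classical in
/-- The quiver `s_i Q`, for a source `i` of `Q`: the value of the height function at `i` is lowered
by two. -/
def reflect (Q : DynkinQuiver b) (i : b.support) (hi : Q.IsSource i) : DynkinQuiver b where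
  height j := Q.height j - if i = j then 2 else 0
  abs_sub_eq_one j k hjk := by
    have h := Q.abs_sub_eq_one j k hjk
    by_cases h1 : i = j
    · subst h1
      have h2 : i ≠ k := hjk.ne
      have h3 := hi k hjk
      rw [if_pos rfl, if_neg h2]
      rw [abs_of_pos (by omega)] at h
      rw [abs_of_neg (by omega)]
      omega
    · by_cases h2 : i = k
      · subst h2
        have h3 := hi j hjk.symm
        rw [if_neg h1, if_pos rfl]
        rw [abs_of_neg (by omega)] at h
        rw [abs_of_pos (by omega)]
        omega
      · rw [if_neg h1, if_neg h2, sub_zero, sub_zero]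
        exact h

/-- The word `i_1 ⋯ i_l` is adapted to `Q`: `i_k` is a source of `s_{i_{k-1}} ⋯ s_{i_1} Q` for
all `k`. -/
def IsAdapted : DynkinQuiver b → List b.support → Prop
  | _, [] => True
  | Q, i :: w => ∃ hi : Q.IsSource i, (Q.reflect i hi).IsAdapted w

/-- The quiver `s_{i_l} ⋯ s_{i_1} Q`, for a word `i_1 ⋯ i_l` adapted to `Q`. -/
def reflectWord : (Q : DynkinQuiver b) → (w : List b.support) → Q.IsAdapted w → DynkinQuiver b
  | Q, [], _ => Q
  | Q, i :: w, h => (Q.reflect i h.fst).reflectWord w h.snd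

/-- The set `[Q]` of all `Q`-adapted reduced expressions of `w_0`. -/
def adaptedClass [P.IsRootSystem] (Q : DynkinQuiver b) : Set (List b.support) :=
  {w | IsReducedExpr b w (longestElement b) ∧ Q.IsAdapted w}

end DynkinQuiver

end Dynkin

end DynkinQuivers

end

/-! The engine is source firing: lowering a height function by two at a source. In an adapted word,
a source commutes past everything before its first occurrence (`exists_cons_of_mem_adaptedTo`), so
adapted words with the same letter multiplicities are commutation equivalent
(`eqvGen_swap_of_perm`). On a connected graph any height function is reached from any other by a
constant shift and firings (`height_induction`). Hence a property that survives both moves need only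
be checked for one height function.

For `w_0` the propagated property is `IsBalanced`: there is an adapted reduced expression after
which the height at `i` is `ξ_{i^*} - h`. Since `i ↦ i^*` is a diagram automorphism, this final
height function says exactly that `i^*` can be fired after the word, so rotating the word preserves
balance (`IsBalanced.rotate`).

The starting case comes from a two-colouring `X`, `Y` of the diagram. Perron–Frobenius gives a
functional, positive on simple roots, that is an eigenvector of the Cartan matrix
(`exists_eigenfunctional`). Composed with the partial products of `XYXY⋯`, it stays proportional to
itself on each colour, so a whole colour changes sign at once and the alternating word remains
reduced until it equals `w_0`. The number of blocks is the order of the product of `XY`, that is,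
the Coxeter number. A one-vertex diagram is treated directly. Summing the balance formula over the
vertices gives `h · n = 2|Φ⁺|`.

Uniqueness up to commutation has two sources. Adapted reduced expressions of one element have equal
letter multiplicities (`perm_of_adaptedTo_of_isReducedExpr`). For Coxeter elements, repetition-free
words with equal letters and equal product are commutation equivalent
(`eqvGen_swap_of_wordProd_eq`). Both follow from watching a single simple-root coordinate.

Positive definiteness makes the diagram a tree (`ncard_edgeSet_lt`). So every ordering of the
vertices is adapted to some height function, all such products are conjugate, and height functions
modulo constants are the `2^(n-1)` orientations. Adapted classes form a full `r`-cluster point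
because rotation can also be undone inside them (`exists_reflect_eq`). -/

namespace DynkinQuivers

open RootPairing

/-! ### Commutation of words and source firing on a graph. -/

section Words

variable {V : Type*} (G : SimpleGraph V)

/-- Exchange of two neighbouring distinct letters which are not joined by an edge. -/
def Swap (w w' : List V) : Prop :=
  ∃ (u v : List V) (i k : V), i ≠ k ∧ ¬ G.Adj i k ∧ w = u ++ i :: k :: v ∧ w' = u ++ k :: i :: v

/-- The vertex `i` is a strict local maximum of `ξ`. -/
def IsSourceOf (ξ : V → ℤ) (i : V) : Prop := ∀ j, G.Adj i j → ξ j < ξ i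

variable {G}

theorem Swap.symm {w w' : List V} (h : Swap G w w') : Swap G w' w := by
  obtain ⟨u, v, i, k, h1, h2, h3, h4⟩ := h
  exact ⟨u, v, k, i, h1.symm, fun h => h2 h.symm, h4, h3⟩

theorem Swap.perm {w w' : List V} (h : Swap G w w') : w.Perm w' := by
  obtain ⟨u, v, i, k, -, -, rfl, rfl⟩ := h
  exact (List.Perm.swap _ _ _).append_left _

theorem Swap.append_left {w w' : List V} (h : Swap G w w') (l : List V) :
    Swap G (l ++ w) (l ++ w') := by
  obtain ⟨u, v, i, k, h1, h2, rfl, rfl⟩ := h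
  exact ⟨l ++ u, v, i, k, h1, h2, by simp, by simp⟩

theorem eqvGen_swap_perm {w w' : List V} (h : Relation.EqvGen (Swap G) w w') : w.Perm w' := by
  induction h with
  | rel _ _ h => exact h.perm
  | refl _ => exact List.Perm.refl _
  | symm _ _ _ ih => exact ih.symm
  | trans _ _ _ _ _ ih1 ih2 => exact ih1.trans ih2

theorem eqvGen_swap_cons {w w' : List V} (h : Relation.EqvGen (Swap G) w w') (a : V) :
    Relation.EqvGen (Swap G) (a :: w) (a :: w') := by
  induction h with
  | rel _ _ h => exact .rel _ _ (h.append_left [a])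
  | refl _ => exact .refl _
  | symm _ _ _ ih => exact ih.symm
  | trans _ _ _ _ _ ih1 ih2 => exact ih1.trans _ _ _ ih2

/-- A predicate invariant under exchanges is invariant under the generated equivalence. -/
theorem eqvGen_swap_iff {p : List V → Prop} (hp : ∀ w w', Swap G w w' → p w → p w')
    {w w' : List V} (h : Relation.EqvGen (Swap G) w w') : p w ↔ p w' := by
  induction h with
  | rel _ _ h => exact ⟨hp _ _ h, hp _ _ h.symm⟩
  | refl _ => rfl
  | symm _ _ _ ih => exact ih.symm
  | trans _ _ _ _ _ ih1 ih2 => exact ih1.trans ih2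

theorem eqvGen_swap_move_front {u v : List V} {i : V} (h : ∀ k ∈ u, k ≠ i ∧ ¬ G.Adj k i) :
    Relation.EqvGen (Swap G) (u ++ i :: v) (i :: (u ++ v)) := by
  induction u with
  | nil => exact .refl _
  | cons k u ih =>
    have h1 := eqvGen_swap_cons (ih fun k hk => h k (List.mem_cons_of_mem _ hk)) k
    have hk := h k List.mem_cons_self
    exact h1.trans _ _ _ (.rel _ _ ⟨[], u ++ v, k, i, hk.1, hk.2, rfl, rfl⟩)

/-- On a connected graph, functions with equal differences along edges differ by a constant. -/
theorem exists_eq_add_const (hG : G.Connected) {ξ ξ' : V → ℤ}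
    (h : ∀ i j, G.Adj i j → ξ i - ξ j = ξ' i - ξ' j) : ∃ k : ℤ, ∀ i, ξ i = ξ' i + k := by
  obtain ⟨r⟩ := hG.nonempty
  refine ⟨ξ r - ξ' r, fun i => ?_⟩
  obtain ⟨p⟩ := hG.preconnected i r
  induction p with
  | nil => ring
  | cons hadj _ ih => have := h _ _ hadj; omega

variable [DecidableEq V]

/-- The function `ξ` lowered by two at each occurrence of a letter in a word. -/
def lower (ξ : V → ℤ) (w : List V) (j : V) : ℤ := ξ j - 2 * w.count j

theorem lower_nil (ξ : V → ℤ) : lower ξ [] = ξ := by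
  ext; simp [lower]

theorem lower_append (ξ : V → ℤ) (u v : List V) : lower ξ (u ++ v) = lower (lower ξ u) v := by
  ext; simp [lower]; ring

theorem lower_singleton_same (ξ : V → ℤ) (i : V) : lower ξ [i] i = ξ i - 2 := by
  simp [lower]

theorem lower_singleton_of_ne (ξ : V → ℤ) {i j : V} (h : i ≠ j) : lower ξ [i] j = ξ j := by
  simp [lower, h]

variable (G) in
/-- The word `w` fires sources of `ξ` successively. -/
def AdaptedTo : (V → ℤ) → List V → Prop
  | _, [] => True
  | ξ, i :: w => IsSourceOf G ξ i ∧ AdaptedTo (lower ξ [i]) w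

theorem adaptedTo_append {ξ : V → ℤ} {u v : List V} :
    AdaptedTo G ξ (u ++ v) ↔ AdaptedTo G ξ u ∧ AdaptedTo G (lower ξ u) v := by
  induction u generalizing ξ with
  | nil => simp [AdaptedTo, lower_nil]
  | cons i u ih =>
    rw [List.cons_append, AdaptedTo, AdaptedTo, ih, and_assoc, ← lower_append]
    rfl

/-- Firing a vertex changes neither the height of a distinct non-neighbour nor the heights of that
vertex's neighbours, so two such firings are independent. -/
theorem Swap.adaptedTo {w w' : List V} (h : Swap G w w') {ξ : V → ℤ} (hw : AdaptedTo G ξ w) :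
    AdaptedTo G ξ w' := by
  obtain ⟨u, v, i, k, h1, h2, rfl, rfl⟩ := h
  rw [adaptedTo_append] at hw ⊢
  refine ⟨hw.1, ?_⟩
  generalize lower ξ u = ξ at hw
  obtain ⟨-, hi, hk, hv⟩ := hw
  refine ⟨fun j hj => ?_, fun j hj => ?_, ?_⟩
  · have := hk j hj
    rwa [lower_singleton_of_ne _ h1, lower_singleton_of_ne] at this
    rintro rfl
    exact h2 hj.symm
  · rw [lower_singleton_of_ne _ h1.symm, lower_singleton_of_ne]
    · exact hi j hj
    · rintro rfl
      exact h2 hj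
  · rw [← lower_append] at hv ⊢
    convert hv using 1
    ext j
    simp only [lower, List.cons_append, List.nil_append]
    rw [(List.Perm.swap i k []).count_eq]

theorem eqvGen_swap_adaptedTo {w w' : List V} (h : Relation.EqvGen (Swap G) w w') {ξ : V → ℤ} :
    AdaptedTo G ξ w ↔ AdaptedTo G ξ w' :=
  eqvGen_swap_iff (fun _ _ h => h.adaptedTo) h

/-- Before a source fires, none of its neighbours does. -/
theorem not_adj_of_adaptedTo {ξ : V → ℤ} {i : V} (hi : IsSourceOf G ξ i) {u : List V}
    (hu : AdaptedTo G ξ u) (hiu : i ∉ u) : ∀ k ∈ u, k ≠ i ∧ ¬ G.Adj k i := by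
  induction u generalizing ξ with
  | nil => simp
  | cons k u ih =>
    rw [List.mem_cons, not_or] at hiu
    have hk : ¬ G.Adj k i := fun h => lt_asymm (hi k h.symm) (hu.1 i h)
    have hi' : IsSourceOf G (lower ξ [k]) i := fun j hj => by
      rw [lower_singleton_of_ne _ (Ne.symm hiu.1), lower_singleton_of_ne]
      · exact hi j hj
      · rintro rfl
        exact hk hj.symm
    intro l hl
    rcases List.mem_cons.1 hl with rfl | hl
    · exact ⟨Ne.symm hiu.1, hk⟩
    · exact ih hi' hu.2 hiu.2 l hl

/-- A source occurring in an adapted word can be moved to the front. -/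
theorem exists_cons_of_mem_adaptedTo {ξ : V → ℤ} {i : V} (hi : IsSourceOf G ξ i) {w : List V}
    (hw : AdaptedTo G ξ w) (hiw : i ∈ w) :
    ∃ w', Relation.EqvGen (Swap G) w (i :: w') := by
  obtain ⟨u, v, rfl, hiu⟩ := List.eq_append_cons_of_mem hiw
  exact ⟨_, eqvGen_swap_move_front (not_adj_of_adaptedTo hi (adaptedTo_append.1 hw).1 hiu)⟩

/-- Adapted words with the same multiset of letters are equal up to exchanges. -/
theorem eqvGen_swap_of_perm {ξ : V → ℤ} {w w' : List V} (hw : AdaptedTo G ξ w)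
    (hw' : AdaptedTo G ξ w') (h : w.Perm w') : Relation.EqvGen (Swap G) w w' := by
  induction w generalizing ξ w' with
  | nil => rw [List.nil_perm.1 h]; exact .refl _
  | cons i w ih =>
    obtain ⟨v, hv⟩ := exists_cons_of_mem_adaptedTo hw.1 hw' (h.subset List.mem_cons_self)
    have hv' := (eqvGen_swap_adaptedTo hv).1 hw'
    have := ih hw.2 hv'.2 ((List.perm_cons i).1 (h.trans (eqvGen_swap_perm hv)))
    exact (eqvGen_swap_cons this i).trans _ _ _ hv.symm

theorem adaptedTo_add_const {ξ : V → ℤ} {w : List V} (c : ℤ) :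
    AdaptedTo G (fun j => ξ j + c) w ↔ AdaptedTo G ξ w := by
  induction w generalizing ξ with
  | nil => rfl
  | cons i w ih =>
    have : lower (fun j => ξ j + c) [i] = fun j => lower ξ [i] j + c := by
      ext j; simp only [lower]; ring
    simp only [AdaptedTo, IsSourceOf, this, ih, add_lt_add_iff_right]

variable (G) in
/-- A height function: its values at the two ends of an edge differ by one. -/
def IsHeight (ξ : V → ℤ) : Prop := ∀ i j, G.Adj i j → |ξ i - ξ j| = 1

/-- A height function is determined, up to constants, along the edges at a letter of an
adapted word. -/
theorem sub_eq_sub_of_adaptedTo {ξ ξ' : V → ℤ} (hξ : IsHeight G ξ) (hξ' : IsHeight G ξ')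
    {w : List V} (hw : AdaptedTo G ξ w) (hw' : AdaptedTo G ξ' w) {i j : V} (hij : G.Adj i j)
    (hi : i ∈ w) : ξ i - ξ j = ξ' i - ξ' j := by
  have key : ∀ (w : List V) (ζ ζ' : V → ℤ), AdaptedTo G ζ w → AdaptedTo G ζ' w → i ∈ w →
      |ζ i - ζ j| = 1 → |ζ' i - ζ' j| = 1 → ζ i - ζ j = ζ' i - ζ' j := by
    intro w
    induction w with
    | nil => simp
    | cons k w ih =>
      intro ζ ζ' h h' hi a a'
      -- The first letter of the word lying in `{i, j}` must be the higher end for both height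
      -- functions; earlier letters leave both ends alone.
      by_cases h1 : k = i
      · subst h1
        have b1 := h.1 j hij
        have b2 := h'.1 j hij
        rw [abs_of_pos (by omega)] at a a'
        omega
      by_cases h2 : k = j
      · subst h2
        have b1 := h.1 i hij.symm
        have b2 := h'.1 i hij.symm
        rw [abs_of_neg (by omega)] at a a'
        omega
      have := ih _ _ h.2 h'.2 ((List.mem_cons.1 hi).resolve_left (Ne.symm h1))
      simp only [lower_singleton_of_ne _ h1, lower_singleton_of_ne _ h2] at this
      exact this a a'
  exact key w ξ ξ' hw hw' hi (hξ i j hij) (hξ' i j hij)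

theorem IsHeight.lower {ξ : V → ℤ} (hξ : IsHeight G ξ) {i : V} (hi : IsSourceOf G ξ i) :
    IsHeight G (lower ξ [i]) := by
  intro j k hjk
  have h := hξ j k hjk
  by_cases h1 : i = j
  · subst h1
    have := hi k hjk
    rw [lower_singleton_same, lower_singleton_of_ne _ hjk.ne]
    rw [abs_of_pos (by omega)] at h
    rw [abs_of_neg (by omega)]; omega
  by_cases h2 : i = k
  · subst h2
    have := hi j hjk.symm
    rw [lower_singleton_same, lower_singleton_of_ne _ h1]
    rw [abs_of_neg (by omega)] at h
    rw [abs_of_pos (by omega)]; omega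
  rw [lower_singleton_of_ne _ h1, lower_singleton_of_ne _ h2]; exact h

theorem IsHeight.lower_of_adaptedTo {ξ : V → ℤ} (hξ : IsHeight G ξ) {w : List V}
    (hw : AdaptedTo G ξ w) : IsHeight G (DynkinQuivers.lower ξ w) := by
  induction w generalizing ξ with
  | nil => rwa [lower_nil]
  | cons i w ih =>
    rw [← List.singleton_append, lower_append]
    exact ih (hξ.lower hw.1) hw.2

/-- Any two height functions on a connected graph are related, up to a constant, by firing
sources. -/
theorem height_induction [Finite V] (hG : G.Connected) {p : (V → ℤ) → Prop}
    (hc : ∀ ξ (c : ℤ), p ξ → p (fun j => ξ j + c))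
    (hs : ∀ ξ i, IsHeight G ξ → IsSourceOf G ξ i → p ξ → p (lower ξ [i]))
    {ξ ξ' : V → ℤ} (hξ : IsHeight G ξ) (hξ' : IsHeight G ξ') (h : p ξ) : p ξ' := by
  have := Fintype.ofFinite V
  obtain ⟨r⟩ := hG.nonempty
  have key : ∀ (n : ℕ) (ζ : V → ℤ), IsHeight G ζ → p ζ → (∀ i, ∃ m : ℕ, ζ i - ξ' i = 2 * m) →
      ∑ i, (ζ i - ξ' i) = n → p ξ' := by
    intro n
    induction n using Nat.strong_induction_on with
    | _ n ih =>
      intro ζ hζ hp hpar hsum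
      by_cases hall : ∀ i, ζ i = ξ' i
      · rwa [← funext hall]
      push Not at hall
      obtain ⟨i0, hi0⟩ := hall
      -- Among the vertices still above the target, one of greatest height is a source: a higher
      -- neighbour would have to agree with `ξ'` already, and then `ξ'` would jump by more than one
      -- along that edge.
      obtain ⟨i, hi, hmax⟩ := Finset.exists_max_image (Finset.univ.filter fun i => ζ i ≠ ξ' i) ζ
        ⟨i0, by simpa using hi0⟩
      simp only [Finset.mem_filter, Finset.mem_univ, true_and] at hi hmax
      have hsrc : IsSourceOf G ζ i := by
        intro j hj
        by_contra hlt
        have h1 := hζ i j hj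
        have h2 := hξ' i j hj
        obtain ⟨m, hm⟩ := hpar i
        have : ζ j ≠ ξ' j := by
          intro hcon
          rw [abs_eq one_pos.le] at h1 h2
          omega
        have := hmax j this
        rw [abs_eq one_pos.le] at h1
        omega
      have hlow : ∀ j, lower ζ [i] j = ζ j - if j = i then 2 else 0 := fun j => by
        by_cases hj : i = j
        · subst hj; simp [lower_singleton_same]
        · simp [lower_singleton_of_ne _ hj, Ne.symm hj]
      have hsum' : ∑ j, (lower ζ [i] j - ξ' j) = (n : ℤ) - 2 := by
        rw [← hsum]
        simp only [hlow, sub_right_comm _ (ite _ _ _), Finset.sum_sub_distrib]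
        simp
      have hpar' : ∀ j, ∃ m : ℕ, lower ζ [i] j - ξ' j = 2 * m := fun j => by
        obtain ⟨m, hm⟩ := hpar j
        rw [hlow]
        split_ifs with hj
        · subst hj
          -- Here `m ≥ 1`, because `ζ` and `ξ'` differ at the fired vertex.
          exact ⟨m - 1, by omega⟩
        · exact ⟨m, by omega⟩
      have hnn : 0 ≤ (n : ℤ) - 2 := by
        rw [← hsum']
        exact Finset.sum_nonneg fun j _ => by obtain ⟨m, hm⟩ := hpar' j; omega
      exact ih (n - 2) (by omega) _ (hζ.lower hsrc) (hs _ _ hζ hsrc hp) hpar' (by omega)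
  have hparity : ∀ i, ∃ m : ℤ, (ξ i - ξ r) - (ξ' i - ξ' r) = 2 * m := by
    intro i
    obtain ⟨q⟩ := hG.preconnected i r
    induction q with
    | nil => exact ⟨0, by ring⟩
    | cons hadj _ ih =>
      obtain ⟨m, hm⟩ := ih
      have h1 := hξ _ _ hadj
      have h2 := hξ' _ _ hadj
      rw [abs_eq one_pos.le] at h1 h2
      rcases h1 with h1 | h1 <;> rcases h2 with h2 | h2
      exacts [⟨m, by omega⟩, ⟨m + 1, by omega⟩, ⟨m - 1, by omega⟩, ⟨m, by omega⟩]
  choose m hm using hparity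
  obtain ⟨B, hB⟩ : ∃ B : ℤ, ∀ i, -B ≤ m i :=
    ⟨∑ i, |m i|, fun i => neg_le_of_abs_le
      (Finset.single_le_sum (f := fun i => |m i|) (fun i _ => abs_nonneg _) (Finset.mem_univ i))⟩
  -- With this shift the difference from `ξ'` at `i` is `2 (m i + B)`, even and nonnegative
  -- everywhere, so firings alone can remove it.
  set c := ξ' r - ξ r + 2 * B with hcdef
  have hval : ∀ i, ∃ l : ℕ, ξ i + c - ξ' i = 2 * l := fun i => by
    refine ⟨(m i + B).toNat, ?_⟩
    rw [Int.toNat_of_nonneg (by linarith [hB i])]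
    have := hm i
    omega
  have hnn : 0 ≤ ∑ i, (ξ i + c - ξ' i) :=
    Finset.sum_nonneg fun i _ => by obtain ⟨l, hl⟩ := hval i; omega
  refine key (∑ i, (ξ i + c - ξ' i)).toNat _ ?_ (hc ξ c h) hval (Int.toNat_of_nonneg hnn).symm
  intro i j hij
  have := hξ i j hij
  rwa [add_sub_add_right_eq_sub]

end Words

/-! ### Weyl group action, positivity and simple-root coordinates. -/

section Weyl

variable {ι M N : Type*} [AddCommGroup M] [Module ℝ M] [AddCommGroup N] [Module ℝ N]
  {P : RootPairing ι ℝ M N} (b : P.Base)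

theorem ofIdx_smul (i : ι) (v : M) :
    weylGroup.ofIdx P i • v = v - P.coroot' i v • P.root i := by
  rw [weylGroup.ofIdx_smul]
  exact P.reflection_apply i v

theorem s_smul (i : b.support) (v : M) : s b i • v = v - P.coroot' i v • P.root i :=
  ofIdx_smul _ v

theorem perm_ofIdx (i : ι) : P.weylGroupToPerm (weylGroup.ofIdx P i) = P.reflectionPerm i := by
  change (Equiv.indexHom P) (Equiv.reflection P i) = _
  simp

theorem weylGroup_ext {x y : P.weylGroup} (h : ∀ v : M, x • v = y • v) : x = y := by
  apply Subtype.ext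
  apply Equiv.weightHom_injective P
  ext v
  exact h v

theorem ofIdx_mul_self (i : ι) : weylGroup.ofIdx P i * weylGroup.ofIdx P i = 1 := by
  refine weylGroup_ext fun v => ?_
  rw [mul_smul, one_smul, ofIdx_smul, ofIdx_smul]
  simp only [map_sub, map_smul, smul_eq_mul, root_coroot'_eq_pairing, pairing_same]
  module

theorem ofIdx_reflectionPerm (j k : ι) : weylGroup.ofIdx P (P.reflectionPerm j k) =
    weylGroup.ofIdx P j * weylGroup.ofIdx P k * weylGroup.ofIdx P j := by
  refine weylGroup_ext fun v => ?_
  have h : ∀ i (v : M), weylGroup.ofIdx P i • v = P.reflection i v := fun i v => rfl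
  rw [mul_smul, mul_smul]
  simp only [h, reflection_reflectionPerm]
  rfl

theorem weylGroup_induction {p : P.weylGroup → Prop} (hs : ∀ i, p (weylGroup.ofIdx P i))
    (h1 : p 1) (hmul : ∀ x y, p x → p y → p (x * y)) (x : P.weylGroup) : p x := by
  obtain ⟨x, hx⟩ := x
  exact weylGroup.induction P (pred := fun x hx => p ⟨x, hx⟩) hs h1
    (fun x y hx hy => hmul ⟨x, hx⟩ ⟨y, hy⟩) hx

/-- For a generating reflection this is the formula for the reflection in a reflected root; it then
passes to products. -/
theorem ofIdx_conj (x : P.weylGroup) (i : ι) :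
    weylGroup.ofIdx P (P.weylGroupToPerm x i) = x * weylGroup.ofIdx P i * x⁻¹ := by
  induction x using weylGroup_induction generalizing i with
  | hs j =>
    rw [inv_eq_of_mul_eq_one_left (ofIdx_mul_self (P := P) j), perm_ofIdx, ofIdx_reflectionPerm]
  | h1 => rw [map_one, Equiv.Perm.one_apply, one_mul, inv_one, mul_one]
  | hmul x y ihx ihy => rw [map_mul, Equiv.Perm.mul_apply, ihx, ihy]; group

theorem s_mul_self (i : b.support) : s b i * s b i = 1 := ofIdx_mul_self _

theorem s_inv (i : b.support) : (s b i)⁻¹ = s b i := inv_eq_of_mul_eq_one_left (s_mul_self b i)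

theorem wordProd_nil : wordProd b [] = 1 := rfl

theorem wordProd_cons (i : b.support) (w : List b.support) :
    wordProd b (i :: w) = s b i * wordProd b w := by simp [wordProd]

theorem wordProd_append (u v : List b.support) :
    wordProd b (u ++ v) = wordProd b u * wordProd b v := by simp [wordProd]

theorem wordProd_reverse (w : List b.support) : wordProd b w.reverse = (wordProd b w)⁻¹ := by
  induction w with
  | nil => simp [wordProd]
  | cons i w ih =>
    rw [List.reverse_cons, wordProd_append, ih, wordProd_cons, wordProd_cons, wordProd_nil,
      mul_inv_rev, s_inv, mul_one]

/-- The image of the root with index `k` under `x` is positive. -/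
def PosAt (x : P.weylGroup) (k : ι) : Prop := b.IsPos (P.weylGroupToPerm x k)

theorem posAt_mul (x y : P.weylGroup) (k : ι) :
    PosAt b (x * y) k ↔ PosAt b x (P.weylGroupToPerm y k) := by
  rw [PosAt, PosAt, map_mul, Equiv.Perm.mul_apply]

theorem posAt_one (k : ι) : PosAt b 1 k ↔ b.IsPos k := by
  rw [PosAt, map_one, Equiv.Perm.one_apply]

/-- The index of the opposite root. -/
def opp (k : ι) : ι := P.reflectionPerm k k

theorem root_opp (k : ι) : P.root (opp (P := P) k) = - P.root k := by
  simp [opp]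

theorem opp_opp (k : ι) : opp (P := P) (opp (P := P) k) = k := by
  apply P.root.injective
  rw [root_opp, root_opp, neg_neg]

theorem isPos_opp (k : ι) : b.IsPos (opp (P := P) k) ↔ ¬ b.IsPos k := 
  RootPairing.Base.IsPos.neg_iff_not b k

theorem perm_opp (x : P.weylGroup) (k : ι) :
    P.weylGroupToPerm x (opp (P := P) k) = opp (P := P) (P.weylGroupToPerm x k) := by
  apply P.root.injective
  rw [← weylGroup_apply_root, root_opp, root_opp, smul_neg, weylGroup_apply_root]

theorem posAt_opp (x : P.weylGroup) (k : ι) : PosAt b x (opp (P := P) k) ↔ ¬ PosAt b x k := by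
  rw [PosAt, perm_opp, isPos_opp, PosAt]

theorem perm_s_self (i : b.support) : P.weylGroupToPerm (s b i) i = opp (P := P) i := by
  rw [s, perm_ofIdx]; rfl

theorem isPos_simple (i : b.support) : b.IsPos i := Base.isPos_of_mem_support i.2

/-- A linear functional which is positive on simple roots detects positivity. -/
theorem isPos_iff_of_functional {φ : M →ₗ[ℝ] ℝ} (hφ : ∀ i : b.support, 0 < φ (P.root i)) (k : ι) :
    b.IsPos k ↔ 0 < φ (P.root k) := by
  have key : ∀ k, b.IsPos k → 0 < φ (P.root k) := by
    intro k hk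
    obtain ⟨f, hf, hsign, hsum⟩ := b.exists_root_eq_sum_int k
    rw [Base.isPos_iff, Base.height_eq_sum hsum] at hk
    have hpos : 0 < f := hsign.resolve_right fun h =>
      absurd hk (not_lt.2 (Finset.sum_nonpos fun i _ => h.le i))
    rw [hsum, map_sum]
    have hterm : ∀ j ∈ b.support, 0 ≤ φ (f j • P.root j) := fun j hj => by
      rw [map_zsmul, zsmul_eq_mul]
      exact mul_nonneg (by exact_mod_cast hpos.le j) (hφ ⟨j, hj⟩).le
    refine lt_of_le_of_ne (Finset.sum_nonneg hterm) fun h0 => ?_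
    rw [eq_comm, Finset.sum_eq_zero_iff_of_nonneg hterm] at h0
    have : ∑ j ∈ b.support, f j = 0 := Finset.sum_eq_zero fun j hj => by
      have := h0 j hj
      rw [map_zsmul, zsmul_eq_mul, mul_eq_zero] at this
      exact_mod_cast this.resolve_right (hφ ⟨j, hj⟩).ne'
    omega
  refine ⟨key k, fun h => ?_⟩
  by_contra hk
  have := key _ ((isPos_opp b k).2 hk)
  rw [root_opp, map_neg] at this
  linarith

section RootSystem

variable [P.IsRootSystem]

/-- The coefficient of a simple root. -/
noncomputable def coord (i : b.support) : M →ₗ[ℝ] ℝ := b.toWeightBasis.coord i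

theorem coord_simple_same (i : b.support) : coord b i (P.root i) = 1 := by
  simp [coord]

theorem coord_simple_of_ne {i j : b.support} (h : j ≠ i) : coord b i (P.root j) = 0 := by
  simp [coord, h]

theorem coord_nonneg {k : ι} (hk : b.IsPos k) (i : b.support) : 0 ≤ coord b i (P.root k) := by
  by_contra! hlt
  set φ : M →ₗ[ℝ] ℝ := ∑ j, b.toWeightBasis.coord j with hφ
  have hφs : ∀ j : b.support, φ (P.root j) = 1 := fun j => by
    rw [hφ, LinearMap.sum_apply, Finset.sum_eq_single j] <;> simp +contextual [eq_comm]
  set c := - coord b i (P.root k) with hc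
  have hc' : 0 < c := by linarith
  -- A large multiple of the `i`-th coordinate keeps the functional positive on simple roots; the
  -- coefficient is chosen so that the root gets the value `φ - |φ| - 1 < 0`, against
  -- `isPos_iff_of_functional`.
  set ψ : M →ₗ[ℝ] ℝ := φ + ((|φ (P.root k)| + 1) / c) • coord b i with hψ
  have h1 : ∀ j : b.support, 0 < ψ (P.root j) := fun j => by
    simp only [hψ, LinearMap.add_apply, LinearMap.smul_apply, hφs, smul_eq_mul]
    by_cases hj : j = i
    · subst hj
      rw [coord_simple_same]; positivity
    · rw [coord_simple_of_ne b hj]; simp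
  have h2 := (isPos_iff_of_functional b h1 k).1 hk
  simp only [hψ, LinearMap.add_apply, LinearMap.smul_apply, smul_eq_mul] at h2
  have h3 : coord b i (P.root k) = -c := by rw [hc, neg_neg]
  rw [h3, mul_neg, div_mul_cancel₀ _ hc'.ne'] at h2
  linarith [le_abs_self (φ (P.root k))]

theorem isPos_of_coord_pos {k : ι} {i : b.support} (h : 0 < coord b i (P.root k)) : b.IsPos k := by
  by_contra hk
  have := coord_nonneg b ((isPos_opp b k).2 hk) i
  rw [root_opp, map_neg] at this
  linarith

theorem coord_s_smul_of_ne {i j : b.support} (h : j ≠ i) (v : M) :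
    coord b i (s b j • v) = coord b i v := by
  rw [s_smul, map_sub, map_smul, coord_simple_of_ne b h, smul_zero, sub_zero]

theorem coord_wordProd_smul {i : b.support} {w : List b.support} (h : i ∉ w) (v : M) :
    coord b i (wordProd b w • v) = coord b i v := by
  induction w with
  | nil => rw [wordProd_nil, one_smul]
  | cons j w ih =>
    rw [List.mem_cons, not_or] at h
    rw [wordProd_cons, mul_smul, coord_s_smul_of_ne b (Ne.symm h.1), ih h.2]

theorem eq_of_coord_eq {u v : M} (h : ∀ i, coord b i u = coord b i v) : u = v :=
  b.toWeightBasis.ext_elem h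

end RootSystem

/-! ### Length as the number of inversions, and reduced words. -/

section Length

/-- The set of positive roots made negative by `x`. -/
def inversions (x : P.weylGroup) : Set ι := {k | b.IsPos k ∧ ¬ PosAt b x k}

/-- All the roots `s_{i_1} ⋯ s_{i_{k-1}} α_{i_k}` attached to the word are positive. -/
def PosWord (w : List b.support) : Prop :=
  ∀ (u : List b.support) (i : b.support) (v : List b.support), w = u ++ i :: v →
    PosAt b (wordProd b u) i

theorem PosWord.left {b : P.Base} {u v : List b.support} (h : PosWord b (u ++ v)) : PosWord b u := by
  rintro u' i v' rfl
  exact h u' i (v' ++ v) (by simp)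

theorem posWord_nil : PosWord b [] := fun u i v h => by cases u <;> cases h

theorem posWord_concat {u : List b.support} {i : b.support} :
    PosWord b (u ++ [i]) ↔ PosWord b u ∧ PosAt b (wordProd b u) i := by
  refine ⟨fun h => ⟨h.left, h u i [] rfl⟩, ?_⟩
  rintro ⟨h1, h2⟩ u' j v' h
  rcases List.eq_nil_or_concat' v' with rfl | ⟨v', k, rfl⟩
  · obtain ⟨rfl, h'⟩ := List.append_inj' h rfl
    exact List.head_eq_of_cons_eq h' ▸ h2
  · have : u ++ [i] = (u' ++ j :: v') ++ [k] := by rw [h]; simp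
    obtain ⟨rfl, -⟩ := List.append_inj' this rfl
    exact h1 u' j v' rfl

theorem perm_s_perm_s (i : b.support) (k : ι) :
    P.weylGroupToPerm (s b i) (P.weylGroupToPerm (s b i) k) = k := by
  rw [← Equiv.Perm.mul_apply, ← map_mul, s_mul_self, map_one, Equiv.Perm.one_apply]

theorem posAt_mul_s {x : P.weylGroup} {i : b.support} : PosAt b (x * s b i) i ↔ ¬ PosAt b x i := by
  rw [posAt_mul, perm_s_self, posAt_opp]

theorem inversions_one : inversions b (1 : P.weylGroup) = ∅ := by
  ext k; simp [inversions, posAt_one]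

theorem length_le (w : List b.support) : length b (wordProd b w) ≤ w.length :=
  Nat.sInf_le ⟨w, rfl, rfl⟩

variable [Finite ι] [P.IsCrystallographic] [P.IsReduced]

theorem isPos_perm_s {i : b.support} {k : ι} (hk : b.IsPos k) (h : k ≠ i) :
    b.IsPos (P.weylGroupToPerm (s b i) k) := by
  rw [s, perm_ofIdx]
  exact hk.reflectionPerm i.2 h

/-- A simple reflection permutes the positive roots other than its own simple root, which is
therefore the only new inversion. -/
theorem inversions_mul_s {x : P.weylGroup} {i : b.support} (h : PosAt b x i) :
    inversions b (x * s b i) = insert (i : ι) (P.weylGroupToPerm (s b i) '' inversions b x) := by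
  ext k
  rw [Set.mem_insert_iff, Set.mem_image]
  constructor
  · rintro ⟨hk, hx⟩
    by_cases hki : k = i
    · exact .inl hki
    · refine .inr ⟨_, ⟨isPos_perm_s b hk hki, ?_⟩, perm_s_perm_s b i k⟩
      rwa [← posAt_mul]
  · rintro (rfl | ⟨l, ⟨hl, hx⟩, rfl⟩)
    · refine ⟨isPos_simple b i, ?_⟩
      rw [posAt_mul, perm_s_self, posAt_opp]
      exact not_not.2 h
    · have hli : l ≠ i := by rintro rfl; exact hx h
      refine ⟨isPos_perm_s b hl hli, ?_⟩
      rw [posAt_mul, perm_s_perm_s]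
      exact hx

theorem ncard_inversions_mul_s {x : P.weylGroup} {i : b.support} (h : PosAt b x i) :
    (inversions b (x * s b i)).ncard = (inversions b x).ncard + 1 := by
  rw [inversions_mul_s b h, Set.ncard_insert_of_notMem,
    Set.ncard_image_of_injective _ (Equiv.injective _)]
  rintro ⟨l, ⟨hl, hx⟩, hli⟩
  by_cases hl' : l = i
  · subst hl'; exact hx h
  · have := isPos_perm_s b hl hl'
    have h2 : P.weylGroupToPerm (s b i) i = l := by rw [← hli, perm_s_perm_s]
    rw [perm_s_self] at h2
    rw [← h2, isPos_opp] at hl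
    exact hl (isPos_simple b i)

theorem PosWord.ncard_inversions {b : P.Base} {w : List b.support} (h : PosWord b w) :
    (inversions b (wordProd b w)).ncard = w.length := by
  induction w using List.reverseRecOn with
  | nil => rw [wordProd_nil, inversions_one]; simp
  | append_singleton w i ih =>
    rw [posWord_concat] at h
    rw [wordProd_append, wordProd_cons, wordProd_nil, mul_one, ncard_inversions_mul_s b h.2, ih h.1]
    simp

/-- A word which has a negative root attached to it has the same product as a shorter word. -/
theorem exists_shorter_of_not_posWord {w : List b.support} (h : ¬ PosWord b w) :
    ∃ w' : List b.support, w'.length < w.length ∧ wordProd b w' = wordProd b w := by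
  simp only [PosWord, not_forall] at h
  obtain ⟨u, i, v, rfl, h⟩ := h
  suffices H : ∃ u' : List b.support, u'.length + 1 = u.length ∧
      wordProd b u' = wordProd b (u ++ [i]) by
    obtain ⟨u', h1, h2⟩ := H
    refine ⟨u' ++ v, by simp; omega, ?_⟩
    rw [wordProd_append, h2, ← wordProd_append]
    simp
  induction u with
  | nil => exact absurd ((posAt_one b _).2 (isPos_simple b i)) h
  | cons j u ih =>
    by_cases hu : PosAt b (wordProd b u) i
    · rw [wordProd_cons, posAt_mul] at h
      -- This is the exchange argument: `s_j` turns a positive root negative only if that root is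
      -- `α_j`. Hence `u α_i = α_j`, so `s_j = u s_i u⁻¹` and the letters `j` and `i` both cancel.
      have hj : P.weylGroupToPerm (wordProd b u) i = j := by
        by_contra hne
        exact h (isPos_perm_s b hu hne)
      have h2 := ofIdx_conj (wordProd b u) (i : ι)
      rw [hj] at h2
      change s b j = _ * s b i * _ at h2
      refine ⟨u, by simp, ?_⟩
      rw [wordProd_append, wordProd_cons, wordProd_cons, wordProd_nil, h2, mul_one]
      rw [inv_mul_cancel_right, mul_assoc, s_mul_self, mul_one]
    · obtain ⟨u', h1, h2⟩ := ih hu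
      refine ⟨j :: u', by simp [h1], ?_⟩
      rw [wordProd_cons, h2, List.cons_append, wordProd_cons]

theorem exists_wordProd_eq (x : P.weylGroup) : ∃ w, wordProd b w = x := by
  have hs : ∀ k, ∃ w, wordProd b w = weylGroup.ofIdx P k := by
    intro k
    induction k using b.induction_reflect with
    | h₀ i h =>
      obtain ⟨w, hw⟩ := h
      exact ⟨w, by rw [ofIdx_reflectionPerm, hw, ofIdx_mul_self, one_mul]⟩
    | h₁ i hi => exact ⟨[⟨i, hi⟩], by rw [wordProd_cons, wordProd_nil, mul_one]; rfl⟩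
    | h₂ i j h hj =>
      obtain ⟨w, hw⟩ := h
      refine ⟨⟨j, hj⟩ :: w ++ [⟨j, hj⟩], ?_⟩
      rw [ofIdx_reflectionPerm, wordProd_append, wordProd_cons, hw, wordProd_cons, wordProd_nil,
        mul_one]
      rfl
  induction x using weylGroup_induction with
  | hs i => exact hs i
  | h1 => exact ⟨[], rfl⟩
  | hmul x y ihx ihy =>
    obtain ⟨u, hu⟩ := ihx
    obtain ⟨v, hv⟩ := ihy
    exact ⟨u ++ v, by rw [wordProd_append, hu, hv]⟩

theorem exists_isReducedExpr (x : P.weylGroup) : ∃ w, IsReducedExpr b w x := by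
  obtain ⟨w, hw⟩ := exists_wordProd_eq b x
  obtain ⟨w', h1, h2⟩ := Nat.sInf_mem
    (s := {k | ∃ w : List b.support, w.length = k ∧ wordProd b w = x}) ⟨_, w, rfl, hw⟩
  exact ⟨w', h2, h1⟩

theorem IsReducedExpr.posWord {b : P.Base} {w : List b.support} {x : P.weylGroup}
    (h : IsReducedExpr b w x) : PosWord b w := by
  by_contra hw
  obtain ⟨w', h1, h2⟩ := exists_shorter_of_not_posWord b hw
  have := length_le b w'
  rw [h2, h.1, ← h.2] at this
  omega

theorem length_eq_ncard_inversions (x : P.weylGroup) : length b x = (inversions b x).ncard := by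
  obtain ⟨w, hw⟩ := exists_isReducedExpr b x
  rw [← hw.2, ← hw.posWord.ncard_inversions, hw.1]

theorem isReducedExpr_iff {w : List b.support} {x : P.weylGroup} :
    IsReducedExpr b w x ↔ wordProd b w = x ∧ PosWord b w := by
  refine ⟨fun h => ⟨h.1, h.posWord⟩, fun h => ⟨h.1, ?_⟩⟩
  rw [length_eq_ncard_inversions, ← h.1, h.2.ncard_inversions]

theorem length_one : length b (1 : P.weylGroup) = 0 := by
  rw [length_eq_ncard_inversions, inversions_one, Set.ncard_empty]

/-- If a reduced expression ended in `i`, then the element would send `α_i` to a negative root. -/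
theorem eq_one_of_forall_posAt {x : P.weylGroup} (h : ∀ i : b.support, PosAt b x i) : x = 1 := by
  obtain ⟨w, hw⟩ := exists_isReducedExpr b x
  rcases List.eq_nil_or_concat' w with rfl | ⟨w', i, rfl⟩
  · exact hw.1.symm
  · have := ((posWord_concat b).1 hw.posWord).2
    have h2 := h i
    rw [← hw.1, wordProd_append, wordProd_cons, wordProd_nil, mul_one, posAt_mul_s] at h2
    exact absurd this h2

theorem length_inv (x : P.weylGroup) : length b x⁻¹ = length b x := by
  have key : ∀ x : P.weylGroup, length b x⁻¹ ≤ length b x := fun x => by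
    obtain ⟨w, hw⟩ := exists_isReducedExpr b x
    rw [← hw.2, ← w.length_reverse, ← hw.1, ← wordProd_reverse]
    exact length_le b _
  refine le_antisymm (key x) ?_
  simpa using key x⁻¹

/-- A reduced expression starting with `i` of `x` gives `x⁻¹ α_i < 0`. -/
theorem IsReducedExpr.not_posAt_inv {b : P.Base} {i : b.support} {w : List b.support}
    {x : P.weylGroup} (h : IsReducedExpr b (i :: w) x) : ¬ PosAt b x⁻¹ i := by
  intro hp
  have h1 := ncard_inversions_mul_s b hp
  rw [← length_eq_ncard_inversions, ← length_eq_ncard_inversions, length_inv, ← h.2, ← h.1,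
    wordProd_cons, mul_inv_rev, s_inv, mul_assoc, s_mul_self, mul_one, length_inv] at h1
  have := length_le b w
  simp at h1
  omega

theorem IsReducedExpr.tail {b : P.Base} {i : b.support} {w : List b.support} {x : P.weylGroup}
    (h : IsReducedExpr b (i :: w) x) : IsReducedExpr b w (s b i * x) := by
  have h1 : wordProd b w = s b i * x := by
    rw [← h.1, wordProd_cons, ← mul_assoc, s_mul_self, one_mul]
  refine ⟨h1, le_antisymm ?_ (h1 ▸ length_le b w)⟩
  obtain ⟨w', hw'⟩ := exists_isReducedExpr b (s b i * x)
  have h2 := length_le b (i :: w')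
  rw [wordProd_cons, hw'.1, ← mul_assoc, s_mul_self, one_mul, ← h.2] at h2
  rw [← hw'.2]
  simpa using h2

end Length

end Weyl

section Weyl

variable {ι M N : Type*} [AddCommGroup M] [Module ℝ M] [AddCommGroup N] [Module ℝ N]
  {P : RootPairing ι ℝ M N} (b : P.Base)

theorem root_ne_zero (k : ι) : P.root k ≠ 0 := P.ne_zero k

theorem ofIdx_opp (k : ι) : weylGroup.ofIdx P (opp (P := P) k) = weylGroup.ofIdx P k := by
  rw [opp, ofIdx_reflectionPerm, ofIdx_mul_self, one_mul]

/-- The pairing with coroots is invariant under the Weyl group. -/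
theorem coroot'_perm (x : P.weylGroup) (k : ι) (v : M) :
    P.coroot' (P.weylGroupToPerm x k) (x • v) = P.coroot' k v := by
  -- Conjugating a reflection gives the reflection in the moved root. Both sides then subtract
  -- multiples of the same nonzero root, so the coefficients agree.
  have h : weylGroup.ofIdx P (P.weylGroupToPerm x k) • x • v = x • weylGroup.ofIdx P k • v := by
    rw [ofIdx_conj, ← mul_smul, inv_mul_cancel_right, mul_smul]
  rw [ofIdx_smul, ofIdx_smul, smul_sub, smul_comm x, weylGroup_apply_root, sub_right_inj] at h
  exact smul_left_injective ℝ (root_ne_zero _) h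

theorem s_ne_one (i : b.support) : s b i ≠ 1 := fun h => by
  have := posAt_mul_s b (x := 1) (i := i)
  rw [one_mul, h, posAt_one] at this
  exact iff_not_self this

/-! ### The longest element and the involution it induces on vertices. -/

section Longest

variable [P.IsRootSystem]

theorem exists_height_functional : ∃ φ : M →ₗ[ℝ] ℝ, ∀ j : b.support, φ (P.root j) = 1 := by
  refine ⟨b.toWeightBasis.constr ℝ fun _ => (1 : ℝ), fun j => ?_⟩
  rw [← b.toWeightBasis_apply, Module.Basis.constr_basis]

/-- If `φ` is positive on simple roots, then so is `-φ ∘ x`; both functionals detect positivity of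
roots. -/
theorem posAt_iff_not_isPos {x : P.weylGroup} (h : ∀ i : b.support, ¬ PosAt b x i) (k : ι) :
    PosAt b x k ↔ ¬ b.IsPos k := by
  obtain ⟨φ, hφ⟩ := exists_height_functional b
  have h1 := isPos_iff_of_functional b (φ := φ) fun i => by rw [hφ]; exact one_pos
  have h2 := isPos_iff_of_functional b (φ := - φ ∘ₗ DistribSMul.toLinearMap ℝ M x) fun i => by
    have hi := h1 (opp (P := P) (P.weylGroupToPerm x i))
    rw [isPos_opp, root_opp, map_neg, ← weylGroup_apply_root] at hi
    exact hi.1 (h i)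
  rw [← isPos_opp b, h2, PosAt, h1, ← weylGroup_apply_root, root_opp]
  simp

variable [Finite ι]

theorem length_le_longestElement (y : P.weylGroup) : length b y ≤ length b (longestElement b) :=
  (exists_longest b).choose_spec y

variable [P.IsCrystallographic] [P.IsReduced]

theorem not_posAt_longestElement (i : b.support) : ¬ PosAt b (longestElement b) i := fun h => by
  have h1 := ncard_inversions_mul_s b h
  rw [← length_eq_ncard_inversions, ← length_eq_ncard_inversions] at h1
  have := length_le_longestElement b (longestElement b * s b i)
  omega

theorem posAt_longestElement (k : ι) : PosAt b (longestElement b) k ↔ ¬ b.IsPos k :=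
  posAt_iff_not_isPos b (not_posAt_longestElement b) k

/-- The quotient of two elements that both reverse all signs preserves positivity, hence is trivial.
-/
theorem eq_longestElement {x : P.weylGroup} (h : ∀ i : b.support, ¬ PosAt b x i) :
    x = longestElement b := by
  rw [← inv_mul_eq_one]
  refine eq_one_of_forall_posAt b fun i => ?_
  have h1 := posAt_iff_not_isPos b h
    (P.weylGroupToPerm x⁻¹ (P.weylGroupToPerm (longestElement b) i))
  rw [← posAt_mul, mul_inv_cancel, posAt_one] at h1
  have h2 := not_posAt_longestElement b i
  rw [PosAt] at h2
  rw [posAt_mul, PosAt]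
  tauto

theorem longestElement_inv : (longestElement b)⁻¹ = longestElement b := by
  refine eq_longestElement b fun i h => ?_
  have := posAt_longestElement b (P.weylGroupToPerm (longestElement b)⁻¹ i)
  rw [← posAt_mul, mul_inv_cancel, posAt_one] at this
  exact (this.1 (isPos_simple b i)) h

theorem longestElement_mul_self : longestElement b * longestElement b = 1 := by
  exact mul_eq_one_iff_inv_eq.2 (longestElement_inv b)

theorem length_longestElement : length b (longestElement b) = numPosRoots b := by
  rw [length_eq_ncard_inversions, numPosRoots]
  change _ = ({k | b.IsPos k} : Set ι).ncard
  congr 1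
  ext k
  simp [inversions, posAt_longestElement]

theorem perm_longestElement_twice (k : ι) :
    P.weylGroupToPerm (longestElement b) (P.weylGroupToPerm (longestElement b) k) = k := by
  rw [← Equiv.Perm.mul_apply, ← map_mul, longestElement_mul_self, map_one, Equiv.Perm.one_apply]

/-- Otherwise `α_i` is missed by every `-w_0 α_j`, so `s_i` keeps these roots positive. Then `w_0
s_i w_0` keeps every simple root positive and is trivial, forcing `s_i = 1`. -/
theorem exists_longestElement_simple (i : b.support) :
    ∃ j : b.support, P.weylGroupToPerm (longestElement b) i = opp (P := P) (j : ι) := by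
  by_contra! hne
  apply s_ne_one b i
  have : longestElement b * s b i * longestElement b = 1 := by
    refine eq_one_of_forall_posAt b fun j => ?_
    rw [mul_assoc, posAt_mul, posAt_longestElement, map_mul, Equiv.Perm.mul_apply]
    have hj := not_posAt_longestElement b j
    rw [PosAt, ← isPos_opp] at hj
    have h1 : opp (P := P) (P.weylGroupToPerm (longestElement b) j) ≠ (i : ι) := by
      intro h
      refine hne j ?_
      rw [← h, perm_opp, perm_longestElement_twice]
    have h2 := isPos_perm_s b hj h1
    rw [perm_opp, isPos_opp] at h2
    exact h2
  have h := longestElement_mul_self b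
  calc s b i = longestElement b * (longestElement b * s b i * longestElement b) *
        longestElement b := by
        rw [← mul_assoc, ← mul_assoc, h, one_mul, mul_assoc, h, mul_one]
    _ = 1 := by rw [this, mul_one, h]

theorem longestElement_smul_simpleRoot (i : b.support) :
    longestElement b • simpleRoot b i = -simpleRoot b (star b i) := by
  have h : ∃ j : b.support, longestElement b • simpleRoot b i = -simpleRoot b j := by
    obtain ⟨j, hj⟩ := exists_longestElement_simple b i
    exact ⟨j, by rw [simpleRoot, simpleRoot, weylGroup_apply_root, hj, root_opp]⟩
  rw [star, dif_pos h]
  exact h.choose_spec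

theorem perm_longestElement (i : b.support) :
    P.weylGroupToPerm (longestElement b) i = opp (P := P) (star b i : ι) := by
  apply P.root.injective
  rw [root_opp, ← weylGroup_apply_root]
  exact longestElement_smul_simpleRoot b i

theorem star_star (i : b.support) : star b (star b i) = i := by
  have := perm_longestElement_twice b i
  rw [perm_longestElement, perm_opp, perm_longestElement, opp_opp] at this
  exact Subtype.ext this

theorem star_bijective : Function.Bijective (star b) :=
  Function.Involutive.bijective (star_star b)

theorem longestElement_conj_s (i : b.support) :
    longestElement b * s b i * longestElement b = s b (star b i) := by
  have := ofIdx_conj (longestElement b) (i : ι)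
  rw [perm_longestElement, ofIdx_opp, longestElement_inv] at this
  exact this.symm

theorem longestElement_conj_wordProd (w : List b.support) :
    longestElement b * wordProd b w * longestElement b = wordProd b (w.map (star b)) := by
  induction w with
  | nil => rw [wordProd_nil, mul_one, longestElement_mul_self]; rfl
  | cons i w ih =>
    rw [List.map_cons, wordProd_cons, wordProd_cons, ← ih, ← longestElement_conj_s]
    simp only [mul_assoc]
    rw [← mul_assoc (longestElement b) (longestElement b) (wordProd b w * _),
      longestElement_mul_self, one_mul]

theorem pairing_star (i j : b.support) :
    P.pairing (star b i) (star b j) = P.pairing i j := by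
  have h := coroot'_perm (longestElement b) (j : ι) (P.root i)
  rw [weylGroup_apply_root, root_coroot'_eq_pairing, root_coroot'_eq_pairing, perm_longestElement,
    perm_longestElement] at h
  rw [← h, opp, opp, pairing_reflectionPerm_self_left, pairing_reflectionPerm_self_right, neg_neg]

end Longest

/-! ### Edges of the diagram and commuting simple reflections. -/

section Graph

variable [P.IsCrystallographic]

theorem pairing_eq_cast (i j : b.support) : P.pairing i j = (b.cartanMatrix i j : ℝ) := by
  rw [← b.algebraMap_cartanMatrixIn_apply ℤ i j]; rfl

variable [Finite ι]

theorem pairing_nonpos {i j : b.support} (h : i ≠ j) : P.pairing i j ≤ 0 := by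
  rw [pairing_eq_cast]
  exact_mod_cast b.cartanMatrix_le_zero_of_ne i j h

theorem adj_iff {i j : b.support} :
    (dynkinGraph b).Adj i j ↔ i ≠ j ∧ P.pairing i j ≠ 0 := by
  refine ⟨fun h => ⟨h.ne, ?_⟩, fun h => ?_⟩
  · rw [pairing_eq_cast]
    exact_mod_cast (show b.cartanMatrix i j < 0 from h).ne
  · refine lt_of_le_of_ne (b.cartanMatrix_le_zero_of_ne i j h.1) ?_
    have := h.2
    rw [pairing_eq_cast] at this
    exact_mod_cast this

theorem pairing_eq_zero {i j : b.support} (h : i ≠ j) (h' : ¬ (dynkinGraph b).Adj i j) :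
    P.pairing i j = 0 := by
  rw [adj_iff] at h'
  tauto

theorem s_smul_of_not_adj {i j : b.support} (h : i ≠ j) (h' : ¬ (dynkinGraph b).Adj j i) :
    s b i • P.root j = P.root j := by
  rw [s_smul, root_coroot'_eq_pairing, pairing_eq_zero b h.symm h', zero_smul, sub_zero]

theorem s_mul_comm {i j : b.support} (h : i ≠ j) (h' : ¬ (dynkinGraph b).Adj i j) :
    s b i * s b j = s b j * s b i := by
  have h1 := s_smul_of_not_adj b h.symm h'
  have h2 := s_smul_of_not_adj b h fun h => h' h.symm
  refine weylGroup_ext fun v => ?_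
  rw [mul_smul, mul_smul, s_smul b j v, s_smul b i v, smul_sub, smul_sub, smul_comm (s b i),
    smul_comm (s b j), h1, h2, s_smul b j v, s_smul b i v, sub_right_comm]

theorem Swap.wordProd {b : P.Base} {w w' : List b.support} (h : Swap (dynkinGraph b) w w') :
    wordProd b w = wordProd b w' := by
  obtain ⟨u, v, i, k, h1, h2, rfl, rfl⟩ := h
  simp only [wordProd_append, wordProd_cons]
  rw [← mul_assoc (s b i), s_mul_comm b h1 h2, mul_assoc]

theorem eqvGen_swap_wordProd {b : P.Base} {w w' : List b.support}
    (h : Relation.EqvGen (Swap (dynkinGraph b)) w w') : wordProd b w = wordProd b w' :=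
  ((eqvGen_swap_iff (p := fun v => wordProd b v = wordProd b w')
    (fun _ _ h h' => h.wordProd.symm.trans h') h).2 rfl)

theorem adj_star [P.IsRootSystem] [P.IsReduced] (i j : b.support) :
    (dynkinGraph b).Adj (star b i) (star b j) ↔ (dynkinGraph b).Adj i j := by
  rw [adj_iff, adj_iff, pairing_star, (star_bijective b).injective.ne_iff]

end Graph

/-! ### Products of distinct simple reflections. -/

section Nodup

variable [P.IsRootSystem]

theorem coord_s_smul_same (i : b.support) (v : M) :
    coord b i (s b i • v) = coord b i v - P.coroot' i v := by
  rw [s_smul, map_sub, map_smul, coord_simple_same, smul_eq_mul, mul_one]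

/-- Evaluate the `i`-th coordinate on `v⁻¹ α_i`. It starts at `1` and the first word turns it into
`-1`, whereas a word without `i` cannot change it. -/
theorem mem_of_wordProd_eq {u v w : List b.support} {i : b.support} (hu : i ∉ u) (hv : i ∉ v)
    (h : wordProd b (u ++ i :: v) = wordProd b w) : i ∈ w := by
  by_contra hw
  have h1 := coord_wordProd_smul b hw ((wordProd b v)⁻¹ • P.root i)
  rw [← h, wordProd_append, mul_smul, coord_wordProd_smul b hu, wordProd_cons, mul_smul,
    smul_inv_smul, coord_s_smul_same, ← wordProd_reverse,
    coord_wordProd_smul b (by rwa [List.mem_reverse]), coord_simple_same] at h1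
  simp at h1

theorem mem_of_nodup_of_wordProd_eq {w w' : List b.support} (hw : w.Nodup)
    (h : wordProd b w = wordProd b w') {i : b.support} (hi : i ∈ w) : i ∈ w' := by
  obtain ⟨u, v, rfl⟩ := List.append_of_mem hi
  rw [List.nodup_append] at hw
  refine mem_of_wordProd_eq b (fun hu => ?_) (List.nodup_cons.1 hw.2.1).1 h
  exact hw.2.2 i hu i List.mem_cons_self rfl

/-- A vector fixed by a product of distinct simple reflections is fixed by each of them. -/
theorem coroot'_eq_zero_of_fixed {w : List b.support} (hw : w.Nodup) {v : M}
    (h : wordProd b w • v = v) : ∀ i ∈ w, P.coroot' i v = 0 := by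
  induction w with
  | nil => simp
  | cons j w ih =>
    rw [List.nodup_cons] at hw
    have h1 : wordProd b w • v = s b j • v := by
      have h1 := congrArg (s b j • ·) h
      simpa only [wordProd_cons, ← mul_smul, ← mul_assoc, s_mul_self, one_mul] using h1
    have h2 := coord_wordProd_smul b hw.1 v
    rw [h1, coord_s_smul_same, sub_eq_self] at h2
    rw [s_smul, h2, zero_smul, sub_zero] at h1
    intro i hi
    rcases List.mem_cons.1 hi with rfl | hi
    · exact h2
    · exact ih hw.2 h1 i hi

theorem posWord_of_nodup {w : List b.support} (hw : w.Nodup) : PosWord b w := by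
  rintro u i v rfl
  have hu : i ∉ u := fun hu => (List.nodup_append.1 hw).2.2 i hu i List.mem_cons_self rfl
  refine isPos_of_coord_pos b (i := i) ?_
  rw [← weylGroup_apply_root, coord_wordProd_smul b hu, coord_simple_same]
  exact one_pos

/-- Words without repetition that have the same product are equal up to exchanges. -/
theorem eqvGen_swap_of_wordProd_eq [Finite ι] [P.IsCrystallographic] {u v : List b.support}
    (hu : u.Nodup) (huv : u.Perm v) (h : wordProd b u = wordProd b v) :
    Relation.EqvGen (Swap (dynkinGraph b)) u v := by
  classical
  induction v generalizing u with
  | nil => rw [huv.eq_nil]; exact .refl _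
  | cons i v ih =>
    obtain ⟨u₁, u₂, rfl⟩ := List.append_of_mem (huv.mem_iff.2 List.mem_cons_self)
    have hnd := List.nodup_append.1 hu
    have hi₁ : i ∉ u₁ := fun hi => hnd.2.2 i hi i List.mem_cons_self rfl
    have hi₂ : i ∉ u₂ := (List.nodup_cons.1 hnd.2.1).1
    have hiv : i ∉ v := (List.nodup_cons.1 (huv.nodup hu)).1
    -- Since `v` omits `i`, the element `s_i u₁ s_i u₂` preserves the `i`-th coordinate. Spelled
    -- out, this says that the coroot of `i` is invariant under `u₁`.
    have h1 : ∀ z : M, P.coroot' i (wordProd b u₁ • s b i • z) = P.coroot' i (s b i • z) := by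
      intro z
      have h2 : wordProd b v = s b i * wordProd b u₁ * s b i * wordProd b u₂ := by
        rw [wordProd_append, wordProd_cons, wordProd_cons] at h
        rw [mul_assoc, mul_assoc, h, ← mul_assoc, s_mul_self, one_mul]
      have h3 := coord_wordProd_smul b hiv ((wordProd b u₂)⁻¹ • z)
      rw [h2, mul_smul, smul_inv_smul, mul_smul, mul_smul, coord_s_smul_same,
        coord_wordProd_smul b hi₁, coord_s_smul_same, ← wordProd_reverse,
        coord_wordProd_smul b (by rwa [List.mem_reverse])] at h3
      have h4 : P.coroot' i (s b i • z) = - P.coroot' i z := by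
        rw [s_smul, map_sub, map_smul, root_coroot'_eq_pairing, pairing_same, smul_eq_mul]
        ring
      rw [h4]
      linarith
    have h4 : P.weylGroupToPerm (wordProd b u₁)⁻¹ i = i := by
      apply P.coroot.injective
      apply P.toLinearMap.flip.toPerfPair.injective
      ext z
      change P.coroot' _ z = P.coroot' _ z
      have h2 := coroot'_perm (wordProd b u₁)⁻¹ (i : ι) (wordProd b u₁ • z)
      have h3 := h1 (s b i • z)
      rw [← mul_smul (s b i), s_mul_self, one_smul] at h3
      rw [← h3, ← h2, inv_smul_smul]
    have h5 : wordProd b u₁ • P.root i = P.root i := by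
      rw [← h4, ← weylGroup_apply_root, smul_inv_smul, weylGroup_apply_root, h4]
    -- A root fixed by the repetition-free word `u₁` is fixed letter by letter, so no letter of `u₁`
    -- is joined to `i` and `i` can move to the front.
    have h6 := coroot'_eq_zero_of_fixed b hnd.1 h5
    have hmove : ∀ k ∈ u₁, k ≠ i ∧ ¬ (dynkinGraph b).Adj k i := fun k hk => by
      refine ⟨fun h => hi₁ (h ▸ hk), fun hadj => ?_⟩
      exact (adj_iff b).1 hadj.symm |>.2 (h6 k hk)
    have h7 := eqvGen_swap_move_front (v := u₂) hmove
    have h8 : wordProd b (u₁ ++ u₂) = wordProd b v := by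
      have := eqvGen_swap_wordProd h7
      rw [h, wordProd_cons, wordProd_cons] at this
      exact (mul_left_cancel this).symm
    have h9 := (eqvGen_swap_perm h7).symm.trans huv
    refine h7.trans _ _ _ (eqvGen_swap_cons (ih ?_ ((List.perm_cons i).1 h9) h8) i)
    exact (List.nodup_cons.1 ((eqvGen_swap_perm h7).nodup hu)).2

end Nodup

end Weyl

/-! ### Orderings of the vertices and height functions on trees. -/

section Orders

variable {V : Type*} {G : SimpleGraph V} [DecidableEq V]

theorem adaptedTo_iff {ξ : V → ℤ} {w : List V} : AdaptedTo G ξ w ↔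
    ∀ (u : List V) (i : V) (v : List V), w = u ++ i :: v → IsSourceOf G (lower ξ u) i := by
  refine ⟨?_, fun h => ?_⟩
  · rintro h u i v rfl
    exact (adaptedTo_append.1 h).2.1
  · induction w using List.reverseRecOn with
    | nil => trivial
    | append_singleton w i ih =>
      refine adaptedTo_append.2 ⟨ih fun u j v huv => ?_, h w i [] rfl, trivial⟩
      exact h u j (v ++ [i]) (by simp [huv])

/-- A listing of all the vertices which respects the orientation of edges is adapted. -/
theorem adaptedTo_of_pairwise {ξ : V → ℤ} (hξ : IsHeight G ξ) {w : List V} (hw : w.Nodup)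
    (hall : ∀ i, i ∈ w) (h : w.Pairwise fun i j => G.Adj i j → ξ j < ξ i) : AdaptedTo G ξ w := by
  rw [adaptedTo_iff]
  rintro u i v rfl j hij
  have hnd := List.nodup_append.1 hw
  have hi : i ∉ u := fun hu => hnd.2.2 i hu i List.mem_cons_self rfl
  have h1 := hξ i j hij
  rw [abs_eq one_pos.le] at h1
  simp only [lower, List.count_eq_zero_of_not_mem hi]
  by_cases hj : j ∈ u
  · rw [List.count_eq_one_of_mem hnd.1 hj]
    omega
  · rw [List.count_eq_zero_of_not_mem hj]
    have hjv : j ∈ v := by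
      have := hall j
      simp only [List.mem_append, List.mem_cons, hj, hij.ne', false_or] at this
      exact this
    have := (List.pairwise_cons.1 (List.pairwise_append.1 h).2.1).1 j hjv hij
    simpa using this

/-- Every height function has an adapted listing of all the vertices. -/
theorem exists_nodup_adaptedTo [Fintype V] {ξ : V → ℤ} (hξ : IsHeight G ξ) :
    ∃ w : List V, w.Nodup ∧ (∀ i, i ∈ w) ∧ AdaptedTo G ξ w := by
  -- Sorting by decreasing height puts the higher end of each edge first; adjacent vertices never
  -- tie.
  let r : V → V → Prop := fun i j => ξ j ≤ ξ i
  have : Std.Total r := ⟨fun i j => le_total _ _⟩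
  have : IsTrans V r := ⟨fun i j k h1 h2 => le_trans h2 h1⟩
  have : DecidableRel r := fun i j => inferInstanceAs (Decidable (ξ j ≤ ξ i))
  have hperm := List.perm_insertionSort r (Finset.univ : Finset V).toList
  have hnd : ((Finset.univ : Finset V).toList.insertionSort r).Nodup :=
    hperm.symm.nodup (Finset.nodup_toList _)
  have hall : ∀ i, i ∈ (Finset.univ : Finset V).toList.insertionSort r := fun i =>
    hperm.mem_iff.2 (by simp)
  refine ⟨_, hnd, hall, adaptedTo_of_pairwise hξ hnd hall ?_⟩
  refine (List.pairwise_insertionSort r (Finset.univ : Finset V).toList).imp ?_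
  intro i j hr hij
  refine lt_of_le_of_ne hr fun h => ?_
  have := hξ i j hij
  rw [h] at this
  simp at this

omit [DecidableEq V] in
/-- In a connected graph with fewer edges than vertices, every edge joins a vertex to its parent. -/
theorem exists_parent [Finite V] (hG : G.Connected) (hcard : G.edgeSet.ncard < Nat.card V) (r : V) :
    ∃ (p : V → V) (d : V → ℕ), (∀ v, v ≠ r → d (p v) < d v) ∧
      (∀ v, v ≠ r → G.Adj v (p v)) ∧
      ∀ v w, G.Adj v w → (v ≠ r ∧ w = p v) ∨ (w ≠ r ∧ v = p w) := by
  have hex : ∀ v, ∃ w, v ≠ r → G.Adj v w ∧ G.dist w r < G.dist v r := by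
    intro v
    obtain ⟨q, hq⟩ := hG.exists_walk_length_eq_dist v r
    cases q with
    | nil => exact ⟨r, fun h => absurd rfl h⟩
    | @cons _ w _ h q =>
      refine ⟨w, fun _ => ⟨h, ?_⟩⟩
      have := SimpleGraph.dist_le q
      rw [SimpleGraph.Walk.length_cons] at hq
      omega
  choose p hp using hex
  refine ⟨p, fun v => G.dist v r, fun v hv => (hp v hv).2, fun v hv => (hp v hv).1, ?_⟩
  -- The edges from vertices to their parents are distinct, since the distance to `r` drops. There
  -- are one fewer than the vertices, so the edge bound makes them all of the edges.
  let f : {v // v ≠ r} → G.edgeSet := fun v => ⟨s(v.1, p v.1), (hp v.1 v.2).1⟩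
  have hf : Function.Injective f := by
    rintro ⟨v, hv⟩ ⟨w, hw⟩ h
    have h := congrArg Subtype.val h
    simp only [f, Sym2.eq_iff] at h
    rcases h with ⟨h, -⟩ | ⟨h1, h2⟩
    · exact Subtype.ext h
    · have a := (hp v hv).2
      have c := (hp w hw).2
      rw [h2] at a
      rw [← h1] at c
      omega
  have hcard' : Nat.card G.edgeSet ≤ Nat.card {v // v ≠ r} := by
    have h1 : Nat.card {v // v ≠ r} = Nat.card V - 1 := by
      have := Set.ncard_add_ncard_compl ({r} : Set V)
      rw [Set.ncard_singleton] at this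
      change ({r} : Set V)ᶜ.ncard = _
      omega
    rw [h1]
    change G.edgeSet.ncard ≤ _
    omega
  have hsurj := (hf.bijective_of_nat_card_le hcard').2
  intro v w hvw
  obtain ⟨⟨x, hx⟩, h⟩ := hsurj ⟨s(v, w), hvw⟩
  have h := congrArg Subtype.val h
  simp only [f, Sym2.eq_iff] at h
  rcases h with ⟨rfl, h2⟩ | ⟨rfl, h2⟩
  · exact .inl ⟨hx, h2.symm⟩
  · exact .inr ⟨hx, h2.symm⟩

omit [DecidableEq V] in
-- Increments along parent links may be prescribed freely; the recursion terminates because `d`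
-- decreases towards `r`.
theorem exists_fun_of_parent {p : V → V} {d : V → ℕ} {r : V} (hd : ∀ v, v ≠ r → d (p v) < d v)
    (ε : V → ℤ) : ∃ ξ : V → ℤ, ξ r = 0 ∧ ∀ v, v ≠ r → ξ v = ξ (p v) + ε v := by
  classical
  let F : ∀ v, (∀ w, d w < d v → ℤ) → ℤ := fun v ih =>
    if h : v = r then 0 else ih (p v) (hd v h) + ε v
  let wf : WellFounded (fun v w : V => d v < d w) := (measure d).wf
  refine ⟨wf.fix F, ?_, fun v hv => ?_⟩
  · rw [wf.fix_eq]; simp [F]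
  · conv_lhs => rw [wf.fix_eq]
    simp [F, hv]

/-- Every listing of the vertices of a tree is adapted to some height function. -/
theorem exists_height_of_nodup [Finite V] (hG : G.Connected)
    (hcard : G.edgeSet.ncard < Nat.card V) {w : List V} (hw : w.Nodup) (hall : ∀ i, i ∈ w) :
    ∃ ξ : V → ℤ, IsHeight G ξ ∧ AdaptedTo G ξ w := by
  obtain ⟨r⟩ := hG.nonempty
  obtain ⟨p, d, hd, hp, hedge⟩ := exists_parent hG hcard r
  obtain ⟨ξ, -, hξ⟩ := exists_fun_of_parent hd
    -- Each edge is oriented downward from the letter listed first to the letter listed second.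
    fun v => if w.idxOf v < w.idxOf (p v) then 1 else -1
  have hh : IsHeight G ξ := by
    intro v v' h
    rcases hedge v v' h with ⟨h1, rfl⟩ | ⟨h1, rfl⟩
    · rw [hξ v h1]; split_ifs <;> simp
    · rw [hξ v' h1]; split_ifs <;> simp
  refine ⟨ξ, hh, adaptedTo_of_pairwise hh hw hall ?_⟩
  rw [List.pairwise_iff_getElem]
  intro a c ha hc hac hadj
  have h1 := hw.idxOf_getElem a ha
  have h2 := hw.idxOf_getElem c hc
  rcases hedge _ _ hadj with ⟨hr, h⟩ | ⟨hr, h⟩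
  · have := hξ _ hr
    rw [← h, h1, h2, if_pos hac] at this
    omega
  · have := hξ _ hr
    rw [← h, h1, h2, if_neg (by omega)] at this
    omega

end Orders

/-! ### A Perron–Frobenius eigenvector. -/

section PerronFrobenius

variable {V : Type*} [Fintype V] {G : SimpleGraph V}

/-- A symmetric matrix which is positive on the edges of a connected graph and zero on other
off-diagonal places has a positive eigenvector. -/
theorem exists_pos_eigenvector (hG : G.Connected) {S : Matrix V V ℝ} (hS : ∀ i j, S i j = S j i)
    (hadj : ∀ i j, G.Adj i j → 0 < S i j) (hnn : ∀ i j, i ≠ j → 0 ≤ S i j) :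
    ∃ (z : V → ℝ) (c : ℝ), (∀ i, 0 < z i) ∧ ∀ j, ∑ i, S j i * z i = c * z j := by
  classical
  have := hG.nonempty
  let T := Matrix.toEuclideanCLM (n := V) (𝕜 := ℝ) S
  have hT : IsSelfAdjoint T := by
    have : IsSelfAdjoint S := by
      ext i j
      simpa using hS j i
    exact this.map (Matrix.toEuclideanCLM (n := V) (𝕜 := ℝ))
  have hTx : ∀ (x : EuclideanSpace ℝ V) (j : V), T x j = ∑ i, S j i * x i := fun x j => rfl
  have hq : ∀ x, T.reApplyInnerSelf x = ∑ j, ∑ i, S j i * x i * x j := by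
    intro x
    rw [ContinuousLinearMap.reApplyInnerSelf_apply]
    simp only [PiLp.inner_apply, hTx, RCLike.re_to_real, RCLike.inner_apply, conj_trivial,
      Finset.mul_sum]
    refine Finset.sum_congr rfl fun j _ => Finset.sum_congr rfl fun i _ => by ring
  have hne : (Metric.sphere (0 : EuclideanSpace ℝ V) 1).Nonempty :=
    NormedSpace.sphere_nonempty.2 zero_le_one
  obtain ⟨x, hx, hmax⟩ := (isCompact_sphere (0 : EuclideanSpace ℝ V) 1).exists_isMaxOn hne
    (T.reApplyInnerSelf_continuous.continuousOn)
  -- Taking absolute values preserves the norm and does not decrease the quadratic form, because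
  -- off-diagonal entries are nonnegative. So `y` also maximizes it on the sphere and is an
  -- eigenvector.
  let y : EuclideanSpace ℝ V := WithLp.toLp 2 fun i => |x i|
  have hy : ∀ i, y i = |x i| := fun i => rfl
  have hynorm : ‖y‖ = 1 := by
    rw [← mem_sphere_zero_iff_norm.1 hx, EuclideanSpace.norm_eq, EuclideanSpace.norm_eq]
    simp [hy]
  have hle : T.reApplyInnerSelf x ≤ T.reApplyInnerSelf y := by
    rw [hq, hq]
    refine Finset.sum_le_sum fun j _ => Finset.sum_le_sum fun i _ => ?_
    rw [hy, hy, mul_assoc, mul_assoc, ← abs_mul]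
    by_cases h : j = i
    · subst h
      rw [abs_mul_self]
    · exact mul_le_mul_of_nonneg_left (le_abs_self _) (hnn j i h)
  have hymax : IsMaxOn T.reApplyInnerSelf (Metric.sphere 0 ‖y‖) y := by
    rw [hynorm]
    exact fun z hz => le_trans (hmax hz) hle
  have hy0 : y ≠ 0 := by
    intro h
    rw [h, norm_zero] at hynorm
    exact zero_ne_one hynorm
  have heig := (hT.hasEigenvector_of_isMaxOn hy0 hymax).apply_eq_smul
  have hcoord := fun j => congrArg (fun v : EuclideanSpace ℝ V => v j) heig
  refine ⟨y, _, fun i => ?_, hcoord⟩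
  by_contra hi
  have hnn' : ∀ i, 0 ≤ y i := fun i => abs_nonneg _
  have hi0 : y i = 0 := le_antisymm (not_lt.1 hi) (hnn' i)
  -- At a zero of `y` the eigenvalue equation is a vanishing sum of nonnegative terms, so neighbours
  -- are zeros too. Connectedness would then give `y = 0`.
  have hstep : ∀ j k, G.Adj j k → y j = 0 → y k = 0 := by
    intro j k hjk hj
    have h1 : ∑ i, S j i * y i = 0 := by
      refine (hcoord j).trans ?_
      change _ * y j = 0
      rw [hj, mul_zero]
    rw [Finset.sum_eq_zero_iff_of_nonneg] at h1
    · exact (mul_eq_zero.1 (h1 k (Finset.mem_univ k))).resolve_left (hadj j k hjk).ne'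
    · intro l _
      by_cases hl : j = l
      · subst hl; rw [hj, mul_zero]
      · exact mul_nonneg (hnn j l hl) (hnn' l)
  apply hy0
  ext j
  obtain ⟨q⟩ := hG.preconnected i j
  have : ∀ {a c} (q : G.Walk a c), y a = 0 → y c = 0 := by
    intro a c q
    induction q with
    | nil => exact id
    | cons h _ ih => exact fun ha => ih (hstep _ _ h ha)
  exact this q hi0

end PerronFrobenius

/-! ### The symmetrized Cartan matrix: connectedness, acyclicity and an eigenfunctional. -/

section Graph

variable {ι M N : Type*} [AddCommGroup M] [Module ℝ M] [AddCommGroup N] [Module ℝ N]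
  {P : RootPairing ι ℝ M N} (b : P.Base) [Finite ι]

/-- The symmetrized Cartan matrix. -/
theorem exists_symmetrized [P.IsRootSystem] : ∃ (A : Matrix b.support b.support ℝ)
    (r : b.support → ℝ), (∀ i, 0 < r i) ∧ (∀ i j, A i j = A j i) ∧ (∀ i, A i i = 2) ∧
    (∀ i j : b.support, P.pairing i j * r j = A i j * r i) ∧ (Nonempty b.support → 0 < ∑ i, ∑ j, A i j) := by
  classical
  have := Fintype.ofFinite ι
  set B := P.RootForm with hB
  have hpos : ∀ v : M, v ≠ 0 → 0 < B v v := fun v hv =>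
    P.rootForm_pos_of_ne_zero (by rw [rootSpan, IsRootSystem.span_root_eq_top]; trivial) hv
  set r : b.support → ℝ := fun i => √(B (P.root i) (P.root i)) with hr
  have hr0 : ∀ i, 0 < r i := fun i => Real.sqrt_pos.2 (hpos _ (root_ne_zero _))
  have hrr : ∀ i, r i * r i = B (P.root i) (P.root i) := fun i =>
    Real.mul_self_sqrt (hpos _ (root_ne_zero _)).le
  have hpair : ∀ i j : b.support, 2 * B (P.root i) (P.root j) = P.pairing i j * (r j * r j) :=
    fun i j => by rw [hrr]; exact P.toInvariantForm.two_mul_apply_root_root i j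
  -- This is twice the Gram matrix of the normalized simple roots, `r i` being the norm of `α_i`.
  -- The sum of its entries is `2 B(v, v)` for the sum `v` of those unit vectors.
  refine ⟨fun i j => 2 * B (P.root i) (P.root j) / (r i * r j), r, hr0, fun i j => ?_, fun i => ?_,
    fun i j => ?_, fun hne => ?_⟩
  · beta_reduce
    rw [mul_comm (r i)]
    congr 2
    exact P.rootForm_symmetric.eq _ _
  · beta_reduce
    rw [hrr, mul_div_assoc, div_self (hpos _ (root_ne_zero _)).ne', mul_one]
  · beta_reduce
    rw [hpair]
    have := (hr0 i).ne'
    have := (hr0 j).ne'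
    field_simp
  · set v : M := ∑ i, (r i)⁻¹ • P.root i with hv
    have hv0 : v ≠ 0 := by
      intro h0
      obtain ⟨i⟩ := hne
      have := congrArg (coord b i) h0
      rw [hv, map_sum, map_zero, Finset.sum_eq_single i] at this
      · rw [map_smul, coord_simple_same, smul_eq_mul, mul_one] at this
        exact (inv_pos.2 (hr0 i)).ne' this
      · intro j _ hj
        rw [map_smul, coord_simple_of_ne b hj, smul_zero]
      · simp
    have := hpos v hv0
    have h2 : ∑ i : b.support, ∑ j : b.support, 2 * B (P.root i) (P.root j) / (r i * r j) = 2 * B v v := by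
      rw [hv]
      simp only [map_sum, map_smul, LinearMap.sum_apply, LinearMap.smul_apply, smul_eq_mul,
        Finset.mul_sum]
      rw [Finset.sum_comm]
      refine Finset.sum_congr rfl fun i _ => Finset.sum_congr rfl fun j _ => ?_
      rw [div_eq_mul_inv, mul_inv]
      ring
    rw [h2]
    positivity

variable [P.IsCrystallographic]

theorem dynkinGraph_connected [P.IsRootSystem] [P.IsReduced] [P.IsIrreducible] : (dynkinGraph b).Connected := by
  have hM : Nontrivial M := IsIrreducible.nontrivial P
  have : Nonempty b.support := by
    by_contra h
    rw [not_nonempty_iff] at h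
    obtain ⟨u, v, huv⟩ := exists_pair_ne M
    exact huv (eq_of_coord_eq b fun i => h.elim i)
  refine SimpleGraph.connected_iff _ |>.2 ⟨fun i j => ?_, this⟩
  refine b.induction_on_cartanMatrix (fun j => (dynkinGraph b).Reachable i j)
    (SimpleGraph.Reachable.refl i) fun k l hk hkl => ?_
  by_cases h : l = k
  · exact h ▸ hk
  · have : (dynkinGraph b).Adj l k := lt_of_le_of_ne (b.cartanMatrix_le_zero_of_ne l k h) hkl
    exact hk.trans this.symm.reachable

/-- The entry equals a Cartan integer, at most `-1`, times a ratio of root lengths. By symmetry the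
ratio can be taken either way up, and one of the two is at least `1`. -/
theorem symmetrized_le_neg_one [P.IsRootSystem] {A : Matrix b.support b.support ℝ}
    {r : b.support → ℝ} (hr : ∀ i, 0 < r i) (hA : ∀ i j, A i j = A j i)
    (hp : ∀ i j : b.support, P.pairing i j * r j = A i j * r i) {i j : b.support}
    (h : (dynkinGraph b).Adj i j) : A i j ≤ -1 := by
  have hc : ∀ i j : b.support, (dynkinGraph b).Adj i j → P.pairing i j ≤ -1 := fun i j h => by
    rw [pairing_eq_cast]
    have h : b.cartanMatrix i j < 0 := h
    exact_mod_cast (show b.cartanMatrix i j ≤ -1 by omega)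
  have h1 := hc i j h
  have h2 := hc j i h.symm
  have e1 := hp i j
  have e2 := hp j i
  rw [← hA] at e2
  have ri := hr i
  have rj := hr j
  rcases le_total (r i) (r j) with hle | hle
  · by_contra! hlt
    nlinarith
  · by_contra! hlt
    nlinarith

/-- The entries of the symmetrized matrix have positive sum. Diagonal entries contribute `2` each,
and each edge contributes at most `-2`, so `0 < 2n - 2e`. -/
theorem ncard_edgeSet_lt [P.IsRootSystem] [Nonempty b.support] :
    (dynkinGraph b).edgeSet.ncard < Nat.card b.support := by
  classical
  obtain ⟨A, r, hr, hA, hA2, hp, hsum⟩ := exists_symmetrized b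
  have hsum := hsum inferInstance
  have hle : ∀ i j, A i j ≤ (if i = j then 2 else 0) - (if (dynkinGraph b).Adj i j then 1 else 0) := by
    intro i j
    by_cases hij : i = j
    · subst hij
      simp [hA2]
    · by_cases hadj : (dynkinGraph b).Adj i j
      · simpa [hij, hadj] using symmetrized_le_neg_one b hr hA hp hadj
      · have := hp i j
        rw [pairing_eq_zero b hij hadj, zero_mul, eq_comm, mul_eq_zero] at this
        simp [hij, hadj, this.resolve_right (hr i).ne']
  have h1 := hsum.trans_le (Finset.sum_le_sum fun i _ => Finset.sum_le_sum fun j _ => hle i j)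
  have h2 : ∑ i, ∑ j, (if (dynkinGraph b).Adj i j then (1 : ℝ) else 0) =
      2 * (dynkinGraph b).edgeSet.ncard := by
    have h3 := (dynkinGraph b).sum_degrees_eq_twice_card_edges
    rw [← SimpleGraph.coe_edgeFinset, Set.ncard_coe_finset]
    have h4 : ((∑ v, (dynkinGraph b).degree v : ℕ) : ℝ) =
        ((2 * (dynkinGraph b).edgeFinset.card : ℕ) : ℝ) := by rw [h3]
    push_cast at h4
    rw [← h4]
    refine Finset.sum_congr rfl fun i _ => ?_
    rw [Finset.sum_boole, ← SimpleGraph.card_neighborFinset_eq_degree]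
    congr 2
    ext j
    simp
  simp only [Finset.sum_sub_distrib, Finset.sum_ite_eq, Finset.mem_univ, if_true, h2] at h1
  rw [Finset.sum_const, nsmul_eq_mul, Finset.card_univ, ← Nat.card_eq_fintype_card] at h1
  have : ((dynkinGraph b).edgeSet.ncard : ℝ) < Nat.card b.support := by linarith
  exact_mod_cast this

/-- There is a linear functional, positive on simple roots, which is an eigenvector of the Cartan
matrix. -/
theorem exists_eigenfunctional [P.IsRootSystem] [P.IsReduced] [P.IsIrreducible] :
    ∃ (φ : M →ₗ[ℝ] ℝ) (c : ℝ), (∀ i : b.support, 0 < φ (P.root i)) ∧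
      ∀ j : b.support, ∑ i : b.support, P.pairing j i * φ (P.root i) = c * φ (P.root j) := by
  obtain ⟨A, r, hr, hA, hA2, hp, -⟩ := exists_symmetrized b
  obtain ⟨z, c, hz, hzc⟩ := exists_pos_eigenvector (dynkinGraph_connected b) (S := -A)
    (fun i j => by simp [hA i j])
    (fun i j h => by have := symmetrized_le_neg_one b hr hA hp h; simp; linarith)
    (fun i j h => by
      have h1 := hp i j
      have h2 := pairing_nonpos b h
      have : A i j ≤ 0 := by
        by_contra! hlt
        nlinarith [mul_pos hlt (hr i), hr j, mul_nonneg (neg_nonneg.2 h2) (hr j).le]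
      simpa using this)
  -- Rescaling by root lengths turns the eigenvector of the symmetrized matrix into one of the
  -- Cartan matrix; the sign comes from having used `-A`.
  refine ⟨b.toWeightBasis.constr ℝ fun i => r i * z i, -c, fun i => ?_, fun j => ?_⟩
  · rw [← b.toWeightBasis_apply, Module.Basis.constr_basis]
    exact mul_pos (hr i) (hz i)
  · simp only [← b.toWeightBasis_apply, Module.Basis.constr_basis]
    have h1 := hzc j
    have h2 : ∀ i : b.support, P.pairing j i * (r i * z i) = r j * (A j i * z i) := fun i => by
      rw [← mul_assoc, hp]; ring
    simp only [h2, ← Finset.mul_sum]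
    simp only [Matrix.neg_apply, neg_mul, Finset.sum_neg_distrib] at h1
    linear_combination (-r j) * h1

end Graph

/-! ### Independence of the Coxeter number from the chosen ordering. -/

section CoxeterNumber

theorem perm_of_nodup {V : Type*} {w w' : List V} (hw : w.Nodup) (hall : ∀ i, i ∈ w) (hw' : w'.Nodup)
    (hall' : ∀ i, i ∈ w') : w.Perm w' :=
  (List.perm_ext_iff_of_nodup hw hw').2 fun i => by simp [hall i, hall' i]

variable {V : Type*} {G : SimpleGraph V} [DecidableEq V]

theorem lower_of_nodup {w : List V} (hw : w.Nodup) (hall : ∀ i, i ∈ w) (ξ : V → ℤ) (i : V) :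
    lower ξ w i = ξ i - 2 := by
  rw [lower, List.count_eq_one_of_mem hw (hall i)]; ring

/-- Moving the first letter of an adapted listing of the vertices to the end. -/
theorem adaptedTo_rotate {ξ : V → ℤ} {i : V} {w : List V} (hw : (i :: w).Nodup)
    (hall : ∀ j, j ∈ i :: w) (h : AdaptedTo G ξ (i :: w)) :
    AdaptedTo G (lower ξ [i]) (w ++ [i]) := by
  refine adaptedTo_append.2 ⟨h.2, fun j hj => ?_, trivial⟩
  rw [← lower_append, List.singleton_append, lower_of_nodup hw hall, lower_of_nodup hw hall]
  have := h.1 j hj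
  omega

theorem exists_nodup_cons_adaptedTo [Fintype V] {ξ : V → ℤ} (hξ : IsHeight G ξ) {i : V}
    (hi : IsSourceOf G ξ i) : ∃ w : List V, (i :: w).Nodup ∧ (∀ j, j ∈ i :: w) ∧
      AdaptedTo G ξ (i :: w) := by
  obtain ⟨w, hw, hall, had⟩ := exists_nodup_adaptedTo hξ
  obtain ⟨w', h⟩ := exists_cons_of_mem_adaptedTo hi had (hall i)
  exact ⟨w', (eqvGen_swap_perm h).nodup hw, fun j => (eqvGen_swap_perm h).mem_iff.1 (hall j),
    (eqvGen_swap_adaptedTo h).1 had⟩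

/-- Letters of a set of pairwise non-adjacent sources can be fired in any order. -/
theorem adaptedTo_of_forall_source {W : List V} (hW : W.Nodup)
    (hadj : ∀ i ∈ W, ∀ j ∈ W, ¬ G.Adj i j) {ξ : V → ℤ} (h : ∀ i ∈ W, IsSourceOf G ξ i) :
    AdaptedTo G ξ W := by
  induction W generalizing ξ with
  | nil => trivial
  | cons i W ih =>
    rw [List.nodup_cons] at hW
    refine ⟨h i List.mem_cons_self, ih hW.2 (fun k hk l hl =>
      hadj k (List.mem_cons_of_mem _ hk) l (List.mem_cons_of_mem _ hl)) fun k hk j hj => ?_⟩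
    have hik : i ≠ k := fun h => hW.1 (h ▸ hk)
    have hij : i ≠ j := by
      rintro rfl
      exact hadj k (List.mem_cons_of_mem _ hk) i List.mem_cons_self hj
    rw [lower_singleton_of_ne _ hik, lower_singleton_of_ne _ hij]
    exact h k (List.mem_cons_of_mem _ hk) j hj

variable {ι M N : Type*} [AddCommGroup M] [Module ℝ M] [AddCommGroup N] [Module ℝ N]
  {P : RootPairing ι ℝ M N} (b : P.Base) [Finite ι] [P.IsCrystallographic]

/-- Two adapted listings of the vertices have the same product. -/
theorem wordProd_eq_of_adaptedTo [DecidableEq b.support] {ξ : b.support → ℤ} {w w' : List b.support}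
    (hw : w.Nodup) (hall : ∀ i, i ∈ w) (had : AdaptedTo (dynkinGraph b) ξ w)
    (hw' : w'.Nodup) (hall' : ∀ i, i ∈ w') (had' : AdaptedTo (dynkinGraph b) ξ w') :
    wordProd b w = wordProd b w' :=
  eqvGen_swap_wordProd (eqvGen_swap_of_perm had had' (perm_of_nodup hw hall hw' hall'))

variable [P.IsRootSystem] [P.IsReduced] [P.IsIrreducible]

/-- Products of all simple reflections, in any order, have the same order. -/
theorem orderOf_wordProd_of_nodup {w : List b.support} (hw : w.Nodup) (hall : ∀ i, i ∈ w) :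
    orderOf (wordProd b w) = coxeterNumber b := by
  classical
  have hG := dynkinGraph_connected b
  have := hG.nonempty
  have hcard := ncard_edgeSet_lt b
  obtain ⟨ξ, hξ, had⟩ := exists_height_of_nodup hG hcard hw hall
  obtain ⟨ζ, hζ, had'⟩ := exists_height_of_nodup hG hcard
    (w := (Finset.univ : Finset b.support).toList) (Finset.nodup_toList _) (by simp)
  -- Each ordering is adapted to some height function, and firing a source rotates the word, which
  -- conjugates its product by that simple reflection.
  refine height_induction hG (p := fun ξ => ∀ w : List b.support, w.Nodup → (∀ i, i ∈ w) →
    AdaptedTo (dynkinGraph b) ξ w → orderOf (wordProd b w) = coxeterNumber b)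
    ?_ ?_ hζ hξ ?_ w hw hall had
  · intro ξ c h w hw hall had
    exact h w hw hall ((adaptedTo_add_const c).1 had)
  · intro ξ i hξ hi h w hw hall had
    obtain ⟨v, hv, hallv, hadv⟩ := exists_nodup_cons_adaptedTo hξ hi
    have hperm : (i :: v).Perm (v ++ [i]) := (List.perm_append_singleton i v).symm
    rw [wordProd_eq_of_adaptedTo b hw hall had (hperm.nodup hv)
      (fun j => hperm.mem_iff.1 (hallv j)) (adaptedTo_rotate hv hallv hadv), ← h _ hv hallv hadv,
      wordProd_append, wordProd_cons, wordProd_cons, wordProd_nil, mul_one]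
    exact SemiconjBy.orderOf_eq (s b i) (mul_assoc _ _ _).symm
  · intro w hw hall had
    rw [coxeterNumber, wordProd_eq_of_adaptedTo b hw hall had (Finset.nodup_toList _) (by simp)
      had']

end CoxeterNumber

/-! ### Alternating words in a two-coloured diagram. -/

section Bipartite

variable {ι M N : Type*} [AddCommGroup M] [Module ℝ M] [AddCommGroup N] [Module ℝ N]
  {P : RootPairing ι ℝ M N} (b : P.Base)

/-- The word `X Y X ⋯` with `k` factors. -/
def alternating {V : Type*} : List V → List V → ℕ → List V
  | _, _, 0 => []
  | X, Y, k + 1 => X ++ alternating Y X k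

theorem alternating_add {V : Type*} (X Y : List V) (m k : ℕ) : alternating X Y (m + k) =
    alternating X Y m ++ if Even m then alternating X Y k else alternating Y X k := by
  induction m generalizing X Y with
  | zero => simp [alternating]
  | succ m ih =>
    rw [Nat.succ_add, alternating, ih, alternating, List.append_assoc]
    by_cases h : Even m <;> simp [h, Nat.even_add_one]

theorem alternating_succ {V : Type*} (X Y : List V) (k : ℕ) : alternating X Y (k + 1) =
    alternating X Y k ++ if Even k then X else Y := by
  rw [alternating_add]; simp [alternating]

theorem length_alternating_strictMono {V : Type*} {X Y : List V} (hX : X ≠ []) (hY : Y ≠ []) :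
    StrictMono fun k => (alternating X Y k).length := by
  refine strictMono_nat_of_lt_succ fun k => ?_
  rw [alternating_succ, List.length_append]
  have h1 := List.length_pos_iff.2 hX
  have h2 := List.length_pos_iff.2 hY
  split_ifs <;> omega

theorem wordProd_alternating_two_mul {b : P.Base} (X Y : List b.support) (j : ℕ) :
    wordProd b (alternating X Y (2 * j)) = wordProd b (X ++ Y) ^ j := by
  induction j with
  | zero => rfl
  | succ j ih =>
    rw [show 2 * (j + 1) = 2 * j + 1 + 1 by ring, alternating, alternating, pow_succ', ← ih,
      wordProd_append, wordProd_append, wordProd_append, mul_assoc]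

/-- The functional `φ ∘ x` is, on simple roots, proportional to `φ` on each colour class. -/
def IsColourProportional (φ : M →ₗ[ℝ] ℝ) {b : P.Base} (X Y : List b.support) (x : P.weylGroup) : Prop :=
  ∃ s t : ℝ, (∀ i ∈ X, φ (x • P.root i) = s * φ (P.root i)) ∧
    ∀ i ∈ Y, φ (x • P.root i) = t * φ (P.root i)

theorem IsColourProportional.symm {b : P.Base} {X Y : List b.support} {φ : M →ₗ[ℝ] ℝ} {x : P.weylGroup}
    (h : IsColourProportional φ X Y x) : IsColourProportional φ Y X x := by
  obtain ⟨s, t, h1, h2⟩ := h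
  exact ⟨t, s, h2, h1⟩

/-- If `H < H'`, the reduced word starting with `Y` would be at least as long as `Y` followed by the
other reduced word, whose length is already maximal. -/
theorem eq_of_isReducedExpr_alternating [Finite ι] [P.IsRootSystem] {b : P.Base}
    {X Y : List b.support} (hX : X ≠ []) (hY : Y ≠ []) {H H' : ℕ}
    (h : IsReducedExpr b (alternating X Y H) (longestElement b))
    (h' : IsReducedExpr b (alternating Y X H') (longestElement b)) : H = H' := by
  have key : ∀ {X Y : List b.support} {H H' : ℕ}, X ≠ [] → Y ≠ [] →
      IsReducedExpr b (alternating X Y H) (longestElement b) →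
      IsReducedExpr b (alternating Y X H') (longestElement b) → H' ≤ H := by
    intro X Y H H' hX hY h h'
    by_contra! hlt
    have h1 : _ ≤ (alternating Y X H').length :=
      (length_alternating_strictMono hY hX).monotone hlt
    rw [h'.2, ← h.2, Nat.succ_eq_add_one, alternating, List.length_append] at h1
    have := List.length_pos_iff.2 hY
    omega
  exact le_antisymm (key hY hX h' h) (key hX hY h h')

variable [Finite ι] [P.IsCrystallographic]

/-- The letters of `X` and of `Y` are the colour classes of a two-colouring of the diagram. -/
structure IsBipartition (X Y : List b.support) : Prop where
  nodup : (X ++ Y).Nodup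
  mem_or_mem : ∀ i, i ∈ X ∨ i ∈ Y
  not_adj_left : ∀ i ∈ X, ∀ j ∈ X, ¬ (dynkinGraph b).Adj i j
  not_adj_right : ∀ i ∈ Y, ∀ j ∈ Y, ¬ (dynkinGraph b).Adj i j

variable {b} {X Y : List b.support}

theorem IsBipartition.symm (h : IsBipartition b X Y) : IsBipartition b Y X :=
  ⟨List.perm_append_comm.nodup h.nodup, fun i => (h.mem_or_mem i).symm, h.not_adj_right,
    h.not_adj_left⟩

theorem IsBipartition.nodup_left (h : IsBipartition b X Y) : X.Nodup :=
  (List.nodup_append.1 h.nodup).1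

theorem IsBipartition.notMem_right (h : IsBipartition b X Y) {i : b.support} (hi : i ∈ X) :
    i ∉ Y := fun hi' => (List.nodup_append.1 h.nodup).2.2 i hi i hi' rfl

theorem IsBipartition.count_alternating [DecidableEq b.support] (h : IsBipartition b X Y)
    {i : b.support} (hi : i ∈ X) (k : ℕ) : (alternating X Y k).count i = (k + 1) / 2 ∧
      (alternating Y X k).count i = k / 2 := by
  induction k with
  | zero => simp [alternating]
  | succ k ih =>
    rw [alternating, alternating, List.count_append, List.count_append, ih.1, ih.2,
      List.count_eq_one_of_mem h.nodup_left hi, List.count_eq_zero_of_not_mem (h.notMem_right hi)]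
    omega

theorem wordProd_block_smul {W : List b.support} (hW : W.Nodup)
    (hadj : ∀ i ∈ W, ∀ j ∈ W, ¬ (dynkinGraph b).Adj i j) (v : M) :
    wordProd b W • v = v - (W.map fun i : b.support => P.coroot' i v • P.root (i : ι)).sum := by
  induction W with
  | nil => simp [wordProd_nil]
  | cons i W ih =>
    rw [List.nodup_cons] at hW
    have hfix : ∀ k ∈ W, s b i • P.root k = P.root k := fun k hk =>
      s_smul_of_not_adj b (fun h => hW.1 (h ▸ hk))
        (hadj k (List.mem_cons_of_mem _ hk) i List.mem_cons_self)
    rw [wordProd_cons, mul_smul, ih hW.2 (fun k hk l hl =>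
      hadj k (List.mem_cons_of_mem _ hk) l (List.mem_cons_of_mem _ hl)), smul_sub, s_smul b i v,
      List.map_cons, List.sum_cons, sub_sub]
    congr 2
    clear ih hadj hW
    induction W with
    | nil => simp
    | cons k W ih =>
      rw [List.map_cons, List.sum_cons, smul_add, smul_comm, hfix k List.mem_cons_self,
        ih fun l hl => hfix l (List.mem_cons_of_mem _ hl)]

theorem wordProd_block_smul_of_notMem {W : List b.support} {i : b.support} (hi : i ∉ W)
    (hadj : ∀ j ∈ W, ¬ (dynkinGraph b).Adj i j) : wordProd b W • P.root i = P.root i := by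
  induction W with
  | nil => rw [wordProd_nil, one_smul]
  | cons k W ih =>
    rw [List.mem_cons, not_or] at hi
    rw [wordProd_cons, mul_smul, ih hi.2 fun j hj => hadj j (List.mem_cons_of_mem _ hj),
      s_smul_of_not_adj b (Ne.symm hi.1) (hadj k List.mem_cons_self)]

theorem sum_block_self {W : List b.support} (hW : W.Nodup)
    (hadj : ∀ i ∈ W, ∀ j ∈ W, ¬ (dynkinGraph b).Adj i j) {j : b.support} (hj : j ∈ W)
    (f : b.support → ℝ) : (W.map fun i : b.support => P.pairing j i * f i).sum = 2 * f j := by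
  classical
  rw [← List.sum_toFinset _ hW, Finset.sum_eq_single j]
  · rw [pairing_same]
  · intro i hi hij
    rw [pairing_eq_zero b hij.symm (hadj j hj i (List.mem_toFinset.1 hi)), zero_mul]
  · exact fun h => absurd (List.mem_toFinset.2 hj) h

theorem IsBipartition.sum_left_add_sum_right (h : IsBipartition b X Y) (f : b.support → ℝ) :
    (X.map f).sum + (Y.map f).sum = ∑ i, f i := by
  classical
  rw [← List.sum_append, ← List.map_append, ← List.sum_toFinset _ h.nodup]
  congr 1
  ext i
  simpa using h.mem_or_mem i

/-- On `X` the factor `s` changes sign. On `Y`, the eigenvalue equation minus the diagonal term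
shows that the `X`-neighbours of `j` contribute `(c - 2) φ(α_j)`, so the correction is again
proportional to `φ`. -/
theorem IsColourProportional.mul_wordProd (hXY : IsBipartition b X Y) {φ : M →ₗ[ℝ] ℝ} {c : ℝ}
    (hφ : ∀ j : b.support, ∑ i : b.support, P.pairing j i * φ (P.root i) = c * φ (P.root j))
    {x : P.weylGroup} (h : IsColourProportional φ X Y x) :
    IsColourProportional φ X Y (x * wordProd b X) := by
  obtain ⟨s, t, hX, hY⟩ := h
  have key : ∀ j : b.support, φ ((x * wordProd b X) • P.root j) = φ (x • P.root j) -
      s * (X.map fun i : b.support => P.pairing j i * φ (P.root i)).sum := by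
    intro j
    rw [mul_smul, wordProd_block_smul hXY.nodup_left hXY.not_adj_left, smul_sub, map_sub,
      sub_right_inj]
    have : ∀ W : List b.support, (∀ i ∈ W, φ (x • P.root i) = s * φ (P.root i)) →
        φ (x • (W.map fun i : b.support => P.coroot' i (P.root j) • P.root (i : ι)).sum) =
          s * (W.map fun i : b.support => P.pairing j i * φ (P.root i)).sum := by
      intro W hW
      induction W with
      | nil => simp
      | cons k W ih =>
        rw [List.map_cons, List.sum_cons, smul_add, map_add, smul_comm, map_smul,
          hW k List.mem_cons_self, ih fun i hi => hW i (List.mem_cons_of_mem _ hi), List.map_cons,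
          List.sum_cons, root_coroot'_eq_pairing, smul_eq_mul]
        ring
    exact this X hX
  refine ⟨-s, t - s * (c - 2), fun j hj => ?_, fun j hj => ?_⟩
  · rw [key, hX j hj, sum_block_self hXY.nodup_left hXY.not_adj_left hj fun i => φ (P.root i)]
    ring
  · have h1 := hXY.sum_left_add_sum_right fun i : b.support => P.pairing j i * φ (P.root i)
    rw [hφ, sum_block_self hXY.symm.nodup_left hXY.not_adj_right hj fun i => φ (P.root i)] at h1
    rw [key, hY j hj, eq_sub_of_add_eq h1]
    ring

theorem isColourProportional_alternating (hXY : IsBipartition b X Y) {φ : M →ₗ[ℝ] ℝ} {c : ℝ}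
    (hφ : ∀ j : b.support, ∑ i : b.support, P.pairing j i * φ (P.root i) = c * φ (P.root j))
    (k : ℕ) : IsColourProportional φ X Y (wordProd b (alternating X Y k)) := by
  induction k with
  | zero => exact ⟨1, 1, by simp [alternating, wordProd_nil], by simp [alternating, wordProd_nil]⟩
  | succ k ih =>
    rw [alternating_succ, wordProd_append]
    split_ifs
    · exact ih.mul_wordProd hXY hφ
    · exact (ih.symm.mul_wordProd hXY.symm hφ).symm

/-- Letters of a block fix each other's simple roots, so positivity for the whole block can be
tested before any of it is applied. -/
theorem posWord_append_block [P.IsRootSystem] {u W : List b.support} (hu : PosWord b u)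
    (hW : W.Nodup) (hadj : ∀ i ∈ W, ∀ j ∈ W, ¬ (dynkinGraph b).Adj i j)
    (h : ∀ i ∈ W, PosAt b (wordProd b u) i) : PosWord b (u ++ W) := by
  induction W using List.reverseRecOn with
  | nil => simpa
  | append_singleton W i ih =>
    have hnd := List.nodup_append.1 hW
    rw [← List.append_assoc, posWord_concat]
    refine ⟨ih hnd.1 (fun k hk l hl => hadj k (by simp [hk]) l (by simp [hl]))
      fun k hk => h k (by simp [hk]), ?_⟩
    have hfix : P.weylGroupToPerm (wordProd b W) i = i := by
      apply P.root.injective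
      rw [← weylGroup_apply_root]
      exact wordProd_block_smul_of_notMem (fun hi => hnd.2.2 i hi i (by simp) rfl)
        fun j hj => hadj i (by simp) j (by simp [hj])
    rw [wordProd_append, posAt_mul, hfix]
    exact h i (by simp)

theorem not_posAt_append_block {u W : List b.support} (hu : PosWord b (u ++ W))
    (hW : W.Nodup) (hadj : ∀ i ∈ W, ∀ j ∈ W, ¬ (dynkinGraph b).Adj i j) {i : b.support}
    (hi : i ∈ W) : ¬ PosAt b (wordProd b (u ++ W)) i := by
  obtain ⟨W₁, W₂, rfl⟩ := List.append_of_mem hi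
  have hnd := List.nodup_append.1 hW
  have h1 := hu (u ++ W₁) i W₂ (by simp)
  have hfix : P.weylGroupToPerm (wordProd b W₂) i = i := by
    apply P.root.injective
    rw [← weylGroup_apply_root]
    exact wordProd_block_smul_of_notMem (List.nodup_cons.1 hnd.2.1).1
      fun j hj => hadj i hi j (by simp [hj])
  have : u ++ (W₁ ++ i :: W₂) = (u ++ W₁) ++ [i] ++ W₂ := by simp
  rw [this, wordProd_append, posAt_mul, hfix, wordProd_append, wordProd_cons, wordProd_nil,
    mul_one, posAt_mul_s]
  exact not_not.2 h1

variable [P.IsRootSystem] [P.IsReduced]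

theorem PosWord.length_le {w : List b.support} (h : PosWord b w) :
    w.length ≤ length b (longestElement b) := by
  rw [← h.ncard_inversions, ← length_eq_ncard_inversions]
  exact length_le_longestElement b _

/-- An alternating word is a reduced expression of the longest element. -/
theorem exists_alternating_isReducedExpr [P.IsIrreducible] (hXY : IsBipartition b X Y)
    (hX : X ≠ []) (hY : Y ≠ []) :
    ∃ H, 0 < H ∧ IsReducedExpr b (alternating X Y H) (longestElement b) := by
  obtain ⟨φ, c, hpos, hφ⟩ := exists_eigenfunctional b
  have hsign : ∀ (x : P.weylGroup) (k : ι), PosAt b x k ↔ 0 < φ (x • P.root k) := fun x k => by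
    rw [PosAt, isPos_iff_of_functional b hpos, weylGroup_apply_root]
  have hex : ∃ k, ¬ PosWord b (alternating X Y k) := by
    by_contra! hall
    have h1 := (hall (length b (longestElement b) + 1)).length_le
    have := (length_alternating_strictMono hX hY).le_apply (x := length b (longestElement b) + 1)
    omega
  classical
  -- Stop at a `k` where the word is reduced but one more block spoils it; word lengths are bounded
  -- by that of `w_0`. Signs are constant on colours, so the next colour is entirely negative. The
  -- last block made its own colour negative, so every simple root is negative.
  obtain ⟨k, hk, hmin⟩ : ∃ k, PosWord b (alternating X Y k) ∧
      ¬ PosWord b (alternating X Y (k + 1)) := by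
    by_contra! hall
    obtain ⟨k, hk⟩ := hex
    exact hk (Nat.rec (posWord_nil b) hall k)
  rw [alternating_succ] at hmin
  obtain ⟨s, t, hs, ht⟩ := isColourProportional_alternating hXY hφ k
  have hsX : ∀ i ∈ X, PosAt b (wordProd b (alternating X Y k)) i ↔ 0 < s := fun i hi => by
    rw [hsign, hs i hi, mul_pos_iff_of_pos_right (hpos i)]
  have hsY : ∀ i ∈ Y, PosAt b (wordProd b (alternating X Y k)) i ↔ 0 < t := fun i hi => by
    rw [hsign, ht i hi, mul_pos_iff_of_pos_right (hpos i)]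
  have hnew : ∀ i ∈ (if Even k then X else Y), ¬ PosAt b (wordProd b (alternating X Y k)) i := by
    split_ifs at hmin ⊢ with hpar
    · intro i hi hp
      rw [hsX i hi] at hp
      exact hmin (posWord_append_block hk hXY.nodup_left hXY.not_adj_left
        fun j hj => (hsX j hj).2 hp)
    · intro i hi hp
      rw [hsY i hi] at hp
      exact hmin (posWord_append_block hk hXY.symm.nodup_left hXY.not_adj_right
        fun j hj => (hsY j hj).2 hp)
  have hk0 : k ≠ 0 := by
    rintro rfl
    obtain ⟨i, hi⟩ := List.exists_mem_of_ne_nil X hX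
    exact hnew i (by simpa using hi) ((posAt_one b _).2 (isPos_simple b i))
  obtain ⟨l, rfl⟩ := Nat.exists_eq_succ_of_ne_zero hk0
  have hold : ∀ i ∈ (if Even l then X else Y),
      ¬ PosAt b (wordProd b (alternating X Y (l + 1))) i := by
    intro i hi
    rw [Nat.succ_eq_add_one, alternating_succ] at hk
    rw [alternating_succ]
    split_ifs at hi hk ⊢
    · exact not_posAt_append_block hk hXY.nodup_left hXY.not_adj_left hi
    · exact not_posAt_append_block hk hXY.symm.nodup_left hXY.not_adj_right hi
  refine ⟨l + 1, Nat.succ_pos l, (isReducedExpr_iff b).2 ⟨eq_longestElement b fun i => ?_, hk⟩⟩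
  simp only [Nat.succ_eq_add_one, Nat.even_add_one] at hnew
  by_cases hpar : Even l
  · simp only [hpar, if_true, not_true_eq_false, if_false] at hnew hold
    exact (hXY.mem_or_mem i).elim (hold i) (hnew i)
  · simp only [hpar, if_true, not_false_eq_true, if_false] at hnew hold
    exact (hXY.mem_or_mem i).elim (hnew i) (hold i)

/-- The involution `i ↦ i^*` preserves or exchanges the colour classes. -/
theorem star_mem_of_isReducedExpr_alternating (hXY : IsBipartition b X Y) {H : ℕ}
    (hH : 0 < H) (h : IsReducedExpr b (alternating X Y H) (longestElement b))
    (h' : IsReducedExpr b (alternating Y X H) (longestElement b)) {i : b.support} (hi : i ∈ X) :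
    star b i ∈ if Even H then X else Y := by
  obtain ⟨m, rfl⟩ := Nat.exists_eq_succ_of_ne_zero hH.ne'
  have h1 := h.1
  have h2 := h'.1
  rw [Nat.succ_eq_add_one, alternating, wordProd_append] at h1
  rw [Nat.succ_eq_add_one, alternating_succ, wordProd_append] at h2
  -- One factorization of `w_0` begins with block `X`, the other ends with a block, and the
  -- remaining factor is common. Hence `w_0` conjugates the last block into `X`.
  have h3 : wordProd b X =
      wordProd b ((if Even m then Y else X).map (star b)) := by
    rw [← longestElement_conj_wordProd]
    rw [← eq_inv_mul_iff_mul_eq] at h1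
    rw [h1, mul_assoc, inv_mul_eq_iff_eq_mul] at h2
    rw [h2, mul_assoc, longestElement_mul_self, mul_one]
  have h4 := mem_of_nodup_of_wordProd_eq b hXY.nodup_left h3 hi
  obtain ⟨j, hj, rfl⟩ := List.mem_map.1 h4
  rw [star_star]
  by_cases hm : Even m <;> simpa [hm, Nat.even_add_one] using hj

/-- The number of factors is the Coxeter number. -/
theorem coxeterNumber_eq_of_isReducedExpr_alternating [P.IsIrreducible]
    (hXY : IsBipartition b X Y) (hX : X ≠ []) (hY : Y ≠ []) {H : ℕ}
    (hH : 0 < H) (h : IsReducedExpr b (alternating X Y H) (longestElement b))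
    (h' : IsReducedExpr b (alternating Y X H) (longestElement b)) : coxeterNumber b = H := by
  rw [← orderOf_wordProd_of_nodup b hXY.nodup (by simpa using hXY.mem_or_mem), orderOf_eq_iff hH]
  have hprod : ∀ k, wordProd b (alternating X Y (H + k)) = longestElement b *
      wordProd b (if Even H then alternating X Y k else alternating Y X k) := fun k => by
    rw [alternating_add, wordProd_append, h.1]
  refine ⟨?_, fun m hm hm0 hone => ?_⟩
  -- The `2H` blocks split into two expressions of `w_0`; for odd `H` the second one starts with
  -- `Y`.
  · rw [← wordProd_alternating_two_mul, two_mul, hprod]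
    split_ifs
    · rw [h.1, longestElement_mul_self]
    · rw [h'.1, longestElement_mul_self]
  -- For `0 < m < H`, the `2m` blocks either form a nonempty reduced prefix or are `w_0` times fewer
  -- than `H` blocks. A trivial product would contradict the length in either case.
  · have hshort : ∀ {X Y : List b.support} {k : ℕ}, X ≠ [] → Y ≠ [] → k < H →
        IsReducedExpr b (alternating X Y H) (longestElement b) →
        length b (wordProd b (alternating X Y k)) = (alternating X Y k).length ∧
          (alternating X Y k).length < length b (longestElement b) := by
      intro X Y k hX hY hk h
      refine ⟨?_, h.2 ▸ length_alternating_strictMono hX hY hk⟩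
      obtain ⟨l, rfl⟩ := Nat.exists_eq_add_of_le hk.le
      have := h.posWord
      rw [alternating_add] at this
      rw [length_eq_ncard_inversions, this.left.ncard_inversions]
    rw [← wordProd_alternating_two_mul] at hone
    rcases lt_or_ge (2 * m) H with hlt | hge
    · have h1 := (hshort hX hY hlt h).1
      rw [hone, length_one] at h1
      have := (length_alternating_strictMono hX hY).le_apply (x := 2 * m)
      omega
    · obtain ⟨k, hk⟩ := Nat.exists_eq_add_of_le hge
      rw [hk, hprod, mul_eq_one_iff_inv_eq, longestElement_inv] at hone
      have hkH : k < H := by omega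
      split_ifs at hone
      · have h1 := hshort hX hY hkH h
        rw [← hone] at h1
        omega
      · have h1 := hshort hY hX hkH h'
        rw [← hone] at h1
        omega

end Bipartite

/-! ### Balanced adapted expressions of the longest element. -/

section Main

variable {ι M N : Type*} [AddCommGroup M] [Module ℝ M] [AddCommGroup N] [Module ℝ N]
  {P : RootPairing ι ℝ M N} {b : P.Base} [Finite ι] [P.IsCrystallographic]

theorem DynkinQuiver.height_reflect [DecidableEq b.support] (Q : DynkinQuiver b) (i : b.support)
    (hi : Q.IsSource i) : (Q.reflect i hi).height = lower Q.height [i] := by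
  ext j
  by_cases h : i = j
  · subst h; simp [DynkinQuiver.reflect, lower]
  · simp [DynkinQuiver.reflect, lower, h]

theorem DynkinQuiver.isAdapted_iff [DecidableEq b.support] (Q : DynkinQuiver b)
    (w : List b.support) : Q.IsAdapted w ↔ AdaptedTo (dynkinGraph b) Q.height w := by
  induction w generalizing Q with
  | nil => simp [DynkinQuiver.IsAdapted, AdaptedTo]
  | cons i w ih =>
    constructor
    · rintro ⟨hi, h⟩
      exact ⟨hi, by rw [← Q.height_reflect i hi]; exact (ih _).1 h⟩
    · rintro ⟨hi, h⟩
      exact ⟨hi, (ih _).2 (by rw [Q.height_reflect i hi]; exact h)⟩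

theorem DynkinQuiver.height_reflectWord [DecidableEq b.support] (Q : DynkinQuiver b)
    (w : List b.support) (hw : Q.IsAdapted w) :
    (Q.reflectWord w hw).height = lower Q.height w := by
  induction w generalizing Q with
  | nil => rw [lower_nil]; rfl
  | cons i w ih =>
    rw [DynkinQuiver.reflectWord, ih, DynkinQuiver.height_reflect, ← lower_append]
    rfl

theorem isReducedExpr_of_eqvGen {w w' : List b.support} {x : P.weylGroup}
    (h : Relation.EqvGen (Swap (dynkinGraph b)) w w') (hw : IsReducedExpr b w x) :
    IsReducedExpr b w' x :=
  ⟨(eqvGen_swap_wordProd h).symm.trans hw.1, (eqvGen_swap_perm h).length_eq.symm.trans hw.2⟩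

variable [P.IsRootSystem] [P.IsReduced]

/-- A word avoiding `i` preserves the `i`-th coordinate, but `w_0` makes `α_i` negative. -/
theorem mem_of_isReducedExpr_longestElement {w : List b.support}
    (hw : IsReducedExpr b w (longestElement b)) (i : b.support) : i ∈ w := by
  by_contra hi
  have h1 := coord_wordProd_smul b hi (P.root i)
  rw [hw.1, coord_simple_same, weylGroup_apply_root, perm_longestElement, root_opp, map_neg] at h1
  have := coord_nonneg b (isPos_simple b (star b i)) i
  linarith

/-- Adapted reduced expressions of the same element have the same letters. -/
theorem perm_of_adaptedTo_of_isReducedExpr [DecidableEq b.support] {ξ : b.support → ℤ}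
    {w w' : List b.support} {x : P.weylGroup} (hw : IsReducedExpr b w x)
    (hw' : IsReducedExpr b w' x) (had : AdaptedTo (dynkinGraph b) ξ w)
    (had' : AdaptedTo (dynkinGraph b) ξ w') : w.Perm w' := by
  induction w generalizing ξ w' x with
  | nil =>
    have := hw'.2.trans hw.2.symm
    rw [List.length_nil, List.length_eq_zero_iff] at this
    rw [this]
  | cons i w ih =>
    -- If `w'` avoided `i`, then `x⁻¹ α_i` would keep `i`-th coordinate `1` and be positive,
    -- although `x` has a reduced expression starting with `i`. Once present, `i` moves to the front
    -- and is cancelled from both words.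
    have hi : i ∈ w' := by
      by_contra hi
      apply hw.not_posAt_inv
      refine isPos_of_coord_pos b (i := i) ?_
      rw [← weylGroup_apply_root, ← hw'.1, ← wordProd_reverse,
        coord_wordProd_smul b (by rwa [List.mem_reverse]), coord_simple_same]
      exact one_pos
    obtain ⟨v, hv⟩ := exists_cons_of_mem_adaptedTo had.1 had' hi
    have h1 := isReducedExpr_of_eqvGen hv hw'
    have h2 := (eqvGen_swap_adaptedTo hv).1 had'
    exact ((ih hw.tail h1.tail had.2 h2.2).cons i).trans (eqvGen_swap_perm hv).symm

/-- This is the identity `s_i w_0 · w_0 s_i w_0 = w_0` together with `s_{i^*} = w_0 s_i w_0`. -/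
theorem isReducedExpr_rotate {i : b.support} {w : List b.support}
    (hw : IsReducedExpr b (i :: w) (longestElement b)) :
    IsReducedExpr b (w ++ [star b i]) (longestElement b) := by
  refine ⟨?_, by rw [← hw.2]; simp⟩
  rw [wordProd_append, hw.tail.1, wordProd_cons, wordProd_nil, mul_one, ← longestElement_conj_s]
  simp only [mul_assoc]
  rw [← mul_assoc (longestElement b) (longestElement b), longestElement_mul_self, one_mul,
    ← mul_assoc, s_mul_self, one_mul]

variable (b) in
/-- The word `w` is an adapted reduced expression of `w_0` with the expected numbers of letters. -/
def IsBalanced [DecidableEq b.support] (ξ : b.support → ℤ) (w : List b.support) : Prop :=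
  IsReducedExpr b w (longestElement b) ∧ AdaptedTo (dynkinGraph b) ξ w ∧
    ∀ i, lower ξ w i = ξ (star b i) - coxeterNumber b

/-- After `i :: w` the heights are those of `ξ` transported by the diagram automorphism and shifted.
Thus `i^*` is a source at the end because `i` was one at the beginning. -/
theorem IsBalanced.rotate [DecidableEq b.support] {ξ : b.support → ℤ} {i : b.support}
    {w : List b.support} (h : IsBalanced b ξ (i :: w)) :
    IsBalanced b (lower ξ [i]) (w ++ [star b i]) := by
  obtain ⟨hred, had, hlow⟩ := h
  refine ⟨isReducedExpr_rotate hred, adaptedTo_append.2 ⟨had.2, fun j hj => ?_, trivial⟩,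
    fun j => ?_⟩
  · rw [← lower_append, List.singleton_append, hlow, hlow, star_star]
    have := had.1 (star b j) ((adj_star b _ _).1 (by rwa [star_star]))
    omega
  · rw [lower_append, ← lower_append ξ, List.singleton_append]
    by_cases hj : star b i = j
    · subst hj
      rw [lower_singleton_same, hlow, star_star, lower_singleton_same]
      ring
    · rw [lower_singleton_of_ne _ hj, hlow, lower_singleton_of_ne]
      rintro rfl
      exact hj (star_star b j)

theorem IsBalanced.exists_cons [DecidableEq b.support] {ξ : b.support → ℤ} {w : List b.support}
    (h : IsBalanced b ξ w) {i : b.support} (hi : IsSourceOf (dynkinGraph b) ξ i) :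
    ∃ w', IsBalanced b ξ (i :: w') := by
  obtain ⟨hred, had, hlow⟩ := h
  obtain ⟨w', hw'⟩ := exists_cons_of_mem_adaptedTo hi had (mem_of_isReducedExpr_longestElement hred i)
  refine ⟨w', isReducedExpr_of_eqvGen hw' hred, (eqvGen_swap_adaptedTo hw').1 had, fun j => ?_⟩
  rw [← hlow, lower, lower, (eqvGen_swap_perm hw').count_eq]

variable [P.IsIrreducible]

variable (b) in
theorem exists_isHeight : ∃ ξ, IsHeight (dynkinGraph b) ξ := by
  classical
  have hG := dynkinGraph_connected b
  have := hG.nonempty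
  obtain ⟨ξ, hξ, -⟩ := exists_height_of_nodup hG (ncard_edgeSet_lt b)
    (w := (Finset.univ : Finset b.support).toList) (Finset.nodup_toList _) (by simp)
  exact ⟨ξ, hξ⟩

theorem exists_isBalanced_of_subsingleton [DecidableEq b.support] [Subsingleton b.support] :
    ∃ ξ w, IsHeight (dynkinGraph b) ξ ∧ IsBalanced b ξ w := by
  obtain ⟨i⟩ := (dynkinGraph_connected b).nonempty
  have hadj : ∀ j k, ¬ (dynkinGraph b).Adj j k := fun j k h => h.ne (Subsingleton.elim _ _)
  have hord : coxeterNumber b = 2 := by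
    rw [← orderOf_wordProd_of_nodup b (List.nodup_singleton i)
      (fun j => by simp [Subsingleton.elim j i])]
    refine orderOf_eq_prime ?_ ?_ <;> rw [wordProd_cons, wordProd_nil, mul_one]
    · rw [pow_two, s_mul_self]
    · exact s_ne_one b i
  refine ⟨0, [i], fun j k h => absurd h (hadj j k), (isReducedExpr_iff b).2
    ⟨eq_longestElement b fun j => ?_, posWord_of_nodup b (List.nodup_singleton i)⟩,
    ⟨fun j h => absurd h (hadj i j), trivial⟩, fun j => ?_⟩
  · rw [Subsingleton.elim j i, wordProd_cons, wordProd_nil, mul_one, ← one_mul (s b i), posAt_mul_s,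
      posAt_one, not_not]
    exact isPos_simple b i
  · rw [Subsingleton.elim j i, lower_singleton_same, hord]
    rfl

theorem exists_isBalanced_of_isBipartition [DecidableEq b.support] {X Y : List b.support}
    (hXY : IsBipartition b X Y) (hX : X ≠ []) (hY : Y ≠ []) :
    ∃ ξ w, IsHeight (dynkinGraph b) ξ ∧ IsBalanced b ξ w := by
  obtain ⟨H, hH, h⟩ := exists_alternating_isReducedExpr hXY hX hY
  obtain ⟨H', hH', h'⟩ := exists_alternating_isReducedExpr hXY.symm hY hX
  obtain rfl := eq_of_isReducedExpr_alternating hX hY h h'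
  have hcox := coxeterNumber_eq_of_isReducedExpr_alternating hXY hX hY hH h h'
  -- The `X`-vertices start one above the `Y`-vertices. After `k` blocks the heights are `-2⌈k/2⌉`
  -- and `-1 - 2⌊k/2⌋`, so the block due next always consists of sources.
  set ξ : b.support → ℤ := fun i => if i ∈ X then 0 else -1 with hξ
  have hξX : ∀ i ∈ X, ξ i = 0 := fun i hi => if_pos hi
  have hξY : ∀ i ∈ Y, ξ i = -1 := fun i hi => if_neg (hXY.symm.notMem_right hi)
  have hlowX : ∀ k, ∀ i ∈ X, lower ξ (alternating X Y k) i = - 2 * ((k + 1) / 2 : ℕ) :=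
    fun k i hi => by rw [lower, hξX i hi, (hXY.count_alternating hi k).1]; ring
  have hlowY : ∀ k, ∀ i ∈ Y, lower ξ (alternating X Y k) i = -1 - 2 * (k / 2 : ℕ) :=
    fun k i hi => by rw [lower, hξY i hi, (hXY.symm.count_alternating hi k).2]
  have hXadj : ∀ i ∈ X, ∀ j, (dynkinGraph b).Adj i j → j ∈ Y := fun i hi j hij =>
    (hXY.mem_or_mem j).resolve_left fun hj => hXY.not_adj_left i hi j hj hij
  have hYadj : ∀ i ∈ Y, ∀ j, (dynkinGraph b).Adj i j → j ∈ X := fun i hi j hij =>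
    (hXY.mem_or_mem j).resolve_right fun hj => hXY.not_adj_right i hi j hj hij
  refine ⟨ξ, alternating X Y H, fun i j hij => ?_, h, ?_, fun i => ?_⟩
  · rcases hXY.mem_or_mem i with hi | hi
    · rw [hξX i hi, hξY j (hXadj i hi j hij)]; norm_num
    · rw [hξY i hi, hξX j (hYadj i hi j hij)]; norm_num
  · have : ∀ k, AdaptedTo (dynkinGraph b) ξ (alternating X Y k) := by
      intro k
      induction k with
      | zero => trivial
      | succ k ih =>
        rw [alternating_succ]
        refine adaptedTo_append.2 ⟨ih, ?_⟩
        split_ifs with hk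
        · refine adaptedTo_of_forall_source hXY.nodup_left hXY.not_adj_left fun i hi j hij => ?_
          rw [hlowX k i hi, hlowY k j (hXadj i hi j hij)]
          obtain ⟨m, rfl⟩ := hk
          omega
        · refine adaptedTo_of_forall_source hXY.symm.nodup_left hXY.not_adj_right
            fun i hi j hij => ?_
          rw [hlowY k i hi, hlowX k j (hYadj i hi j hij)]
          rw [Nat.not_even_iff_odd] at hk
          obtain ⟨m, rfl⟩ := hk
          omega
    exact this H
  · rw [hcox]
    -- For even `H` the involution preserves colours; for odd `H` it exchanges them, and the initial
    -- height difference of one accounts for the rounding.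
    rcases hXY.mem_or_mem i with hi | hi
    · have hs := star_mem_of_isReducedExpr_alternating hXY hH h h' hi
      rw [hlowX H i hi]
      split_ifs at hs with hpar
      · rw [hξX _ hs]
        obtain ⟨m, rfl⟩ := hpar
        omega
      · rw [hξY _ hs]
        rw [Nat.not_even_iff_odd] at hpar
        obtain ⟨m, rfl⟩ := hpar
        omega
    · have hs := star_mem_of_isReducedExpr_alternating hXY.symm hH h' h hi
      rw [hlowY H i hi]
      split_ifs at hs with hpar
      · rw [hξY _ hs]
        obtain ⟨m, rfl⟩ := hpar
        omega
      · rw [hξX _ hs]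
        rw [Nat.not_even_iff_odd] at hpar
        obtain ⟨m, rfl⟩ := hpar
        omega

variable (b) in
-- The parity of any height function two-colours the diagram; an edge guarantees that both colours
-- occur.
theorem exists_isBalanced [DecidableEq b.support] :
    ∃ ξ w, IsHeight (dynkinGraph b) ξ ∧ IsBalanced b ξ w := by
  rcases subsingleton_or_nontrivial b.support with hsub | hnt
  · exact exists_isBalanced_of_subsingleton
  obtain ⟨ξ, hξ⟩ := exists_isHeight b
  have hpar : ∀ i j, (dynkinGraph b).Adj i j → (Even (ξ i) ↔ ¬ Even (ξ j)) := fun i j hij => by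
    have := hξ i j hij
    rw [abs_eq one_pos.le] at this
    rw [Int.even_iff, Int.even_iff]
    omega
  let X := (Finset.univ : Finset b.support).toList.filter fun i => Even (ξ i)
  let Y := (Finset.univ : Finset b.support).toList.filter fun i => ¬ Even (ξ i)
  have hX : ∀ i, i ∈ X ↔ Even (ξ i) := fun i => by simp [X]
  have hY : ∀ i, i ∈ Y ↔ ¬ Even (ξ i) := fun i => by simp [Y]
  have hXY : IsBipartition b X Y := by
    refine ⟨List.nodup_append.2 ⟨(Finset.nodup_toList _).filter _, (Finset.nodup_toList _).filter _,
      ?_⟩, fun i => ?_, fun i hi j hj hij => ?_, fun i hi j hj hij => ?_⟩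
    · rintro i hi j hj rfl
      exact (hY i).1 hj ((hX i).1 hi)
    · rw [hX, hY]; exact em _
    · exact (hpar i j hij).1 ((hX i).1 hi) ((hX j).1 hj)
    · exact (hY i).1 hi ((hpar i j hij).2 ((hY j).1 hj))
  obtain ⟨i, j, hij⟩ : ∃ i j, (dynkinGraph b).Adj i j := by
    obtain ⟨i, j, hij⟩ := exists_pair_ne b.support
    obtain ⟨q⟩ := (dynkinGraph_connected b).preconnected i j
    cases q with
    | nil => exact absurd rfl hij
    | cons h _ => exact ⟨_, _, h⟩
  by_cases hi : Even (ξ i)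
  · exact exists_isBalanced_of_isBipartition hXY (List.ne_nil_of_mem ((hX i).2 hi))
      (List.ne_nil_of_mem ((hY j).2 ((hpar i j hij).1 hi)))
  · refine exists_isBalanced_of_isBipartition hXY (List.ne_nil_of_mem ((hX j).2 ?_))
      (List.ne_nil_of_mem ((hY i).2 hi))
    by_contra hj
    exact hi ((hpar i j hij).2 hj)

/-- Every height function has a balanced adapted reduced expression of `w_0`. -/
theorem IsHeight.exists_isBalanced [DecidableEq b.support] {ξ : b.support → ℤ}
    (hξ : IsHeight (dynkinGraph b) ξ) : ∃ w, IsBalanced b ξ w := by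
  obtain ⟨ζ, w, hζ, hw⟩ := DynkinQuivers.exists_isBalanced b
  refine height_induction (dynkinGraph_connected b) (p := fun ξ => ∃ w, IsBalanced b ξ w)
    ?_ ?_ hζ hξ ⟨w, hw⟩
  · rintro ξ c ⟨w, hred, had, hlow⟩
    refine ⟨w, hred, (adaptedTo_add_const c).2 had, fun i => ?_⟩
    have := hlow i
    simp only [DynkinQuivers.lower] at this ⊢
    linarith
  · rintro ξ i hξ hi ⟨w, hw⟩
    obtain ⟨w', hw'⟩ := hw.exists_cons hi
    exact ⟨_, hw'.rotate⟩

/-- The final heights depend only on letter multiplicities, which all adapted reduced expressions of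
`w_0` share. -/
theorem IsHeight.isBalanced [DecidableEq b.support] {ξ : b.support → ℤ}
    (hξ : IsHeight (dynkinGraph b) ξ) {w : List b.support}
    (hred : IsReducedExpr b w (longestElement b)) (had : AdaptedTo (dynkinGraph b) ξ w) :
    IsBalanced b ξ w := by
  obtain ⟨v, hv⟩ := hξ.exists_isBalanced
  refine ⟨hred, had, fun i => ?_⟩
  rw [← hv.2.2 i, DynkinQuivers.lower, DynkinQuivers.lower,
    (perm_of_adaptedTo_of_isReducedExpr hv.1 hred hv.2.1 had).count_eq]

variable (b) in
-- Sum the balance formula over the vertices: the heights cancel because `i ↦ i^*` is a bijection,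
-- leaving twice the word length against `h` times the number of vertices.
theorem coxeterNumber_mul_card :
    coxeterNumber b * b.support.card = 2 * numPosRoots b := by
  have : DecidableEq b.support := Classical.decEq _
  obtain ⟨ξ, w, -, hred, -, hlow⟩ := exists_isBalanced b
  have h1 : ∑ i, lower ξ w i = ∑ i, (ξ (star b i) - coxeterNumber b) :=
    Finset.sum_congr rfl fun i _ => hlow i
  simp only [lower, Finset.sum_sub_distrib, ← Finset.mul_sum] at h1
  rw [(star_bijective b).sum_comp ξ] at h1
  have h2 : ∑ i : b.support, (w.count i : ℤ) = w.length := by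
    have : ∑ i : b.support, w.count i = w.length := by
      rw [← Multiset.coe_card, ← Multiset.sum_count_eq_card (s := Finset.univ) (by simp)]
      simp
    exact_mod_cast this
  rw [h2, Finset.sum_const, Finset.card_univ, Fintype.card_coe, hred.2,
    length_longestElement] at h1
  simp only [nsmul_eq_mul] at h1
  have : (b.support.card : ℤ) * coxeterNumber b = 2 * numPosRoots b := by linarith
  rw [mul_comm]
  exact_mod_cast this

end Main

theorem nodup_of_card_toFinset_eq {V : Type*} [DecidableEq V] {w : List V}
    (h : w.toFinset.card = w.length) : w.Nodup :=
  Multiset.coe_nodup.1 (Multiset.toFinset_card_eq_card_iff_nodup.1 h)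

/-! ### Dynkin quivers: Coxeter elements, adapted classes and the cluster point. -/

section Assembly

variable {ι M N : Type*} [AddCommGroup M] [Module ℝ M] [AddCommGroup N] [Module ℝ N]
  {P : RootPairing ι ℝ M N} {b : P.Base} [Finite ι] [P.IsCrystallographic]

theorem DynkinQuiver.isHeight (Q : DynkinQuiver b) : IsHeight (dynkinGraph b) Q.height :=
  Q.abs_sub_eq_one

theorem DynkinQuiver.exists_listing (Q : DynkinQuiver b) :
    ∃ w : List b.support, w.Nodup ∧ (∀ i, i ∈ w) ∧ Q.IsAdapted w := by
  classical
  obtain ⟨w, h1, h2, h3⟩ := exists_nodup_adaptedTo Q.isHeight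
  exact ⟨w, h1, h2, (Q.isAdapted_iff w).2 h3⟩

/-- The Coxeter element attached to a Dynkin quiver. -/
noncomputable def DynkinQuiver.coxeterElement (Q : DynkinQuiver b) : P.weylGroup :=
  wordProd b Q.exists_listing.choose

theorem DynkinQuiver.coxeterElement_eq (Q : DynkinQuiver b) {w : List b.support} (hw : w.Nodup)
    (hall : ∀ i, i ∈ w) (had : Q.IsAdapted w) : Q.coxeterElement = wordProd b w := by
  classical
  obtain ⟨h1, h2, h3⟩ := Q.exists_listing.choose_spec
  exact wordProd_eq_of_adaptedTo b h1 h2 ((Q.isAdapted_iff _).1 h3) hw hall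
    ((Q.isAdapted_iff _).1 had)

theorem DynkinQuiver.coxeterElement_reflect (Q : DynkinQuiver b) (i : b.support)
    (hi : Q.IsSource i) :
    s b i * Q.coxeterElement * s b i = (Q.reflect i hi).coxeterElement := by
  classical
  obtain ⟨w, hw, hall, had⟩ := exists_nodup_cons_adaptedTo Q.isHeight hi
  have hperm : (i :: w).Perm (w ++ [i]) := (List.perm_append_singleton i w).symm
  have had' := adaptedTo_rotate hw hall had
  rw [← Q.height_reflect i hi] at had'
  rw [Q.coxeterElement_eq hw hall ((Q.isAdapted_iff _).2 had),
    (Q.reflect i hi).coxeterElement_eq (hperm.nodup hw) (fun j => hperm.mem_iff.1 (hall j))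
      ((DynkinQuiver.isAdapted_iff _ _).2 had'),
    wordProd_cons, wordProd_append, wordProd_cons, wordProd_nil, mul_one, ← mul_assoc,
    s_mul_self, one_mul]

theorem self_mem_commutationClass (w : List b.support) : w ∈ commutationClass b w :=
  Relation.EqvGen.refl w

variable [P.IsRootSystem]

theorem DynkinQuiver.adaptedClass_congr {Q Q' : DynkinQuiver b} {k : ℤ}
    (h : ∀ i, Q.height i = Q'.height i + k) : Q.adaptedClass = Q'.adaptedClass := by
  classical
  ext w
  rw [adaptedClass, adaptedClass, Set.mem_ofPred_eq, Set.mem_ofPred_eq, Q.isAdapted_iff,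
    Q'.isAdapted_iff, funext h, adaptedTo_add_const]

variable [P.IsReduced]

/-- A list of length `n` containing all `n` vertices has no repetition; conversely, repetition-free
words are automatically reduced. -/
theorem isCoxeterElement_iff {x : P.weylGroup} : IsCoxeterElement b x ↔
    ∃ w : List b.support, w.Nodup ∧ (∀ i, i ∈ w) ∧ wordProd b w = x := by
  classical
  constructor
  · rintro ⟨w, hw, hlen, hall⟩
    refine ⟨w, ?_, hall, hw.1⟩
    have h1 : w.toFinset = Finset.univ := by ext i; simpa using hall i
    refine nodup_of_card_toFinset_eq ?_
    rw [h1, Finset.card_univ, Fintype.card_coe, hlen]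
  · rintro ⟨w, hw, hall, rfl⟩
    refine ⟨w, (isReducedExpr_iff b).2 ⟨rfl, posWord_of_nodup b hw⟩, ?_, hall⟩
    have h1 : w.toFinset = Finset.univ := by ext i; simpa using hall i
    rw [← List.toFinset_card_of_nodup hw, h1, Finset.card_univ, Fintype.card_coe]

/-- A reduced expression of a product of all simple reflections is a listing of them. -/
theorem nodup_of_isReducedExpr {w w' : List b.support} (hw : w.Nodup) (hall : ∀ i, i ∈ w)
    (h : IsReducedExpr b w' (wordProd b w)) : w'.Nodup ∧ ∀ i, i ∈ w' := by
  classical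
  have hall' : ∀ i, i ∈ w' := fun i => mem_of_nodup_of_wordProd_eq b hw h.1.symm (hall i)
  refine ⟨nodup_of_card_toFinset_eq ?_, hall'⟩
  have h1 : w'.toFinset = w.toFinset := by ext i; simp [hall i, hall' i]
  rw [h1, List.toFinset_card_of_nodup hw, h.2, length_eq_ncard_inversions,
    (posWord_of_nodup b hw).ncard_inversions]

theorem DynkinQuiver.eq_coxeterElement_iff (Q : DynkinQuiver b) (x : P.weylGroup) :
    (IsCoxeterElement b x ∧ ∃ w, IsReducedExpr b w x ∧ Q.IsAdapted w) ↔ x = Q.coxeterElement := by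
  constructor
  · rintro ⟨hx, w', hw', had⟩
    obtain ⟨w, hw, hall, rfl⟩ := isCoxeterElement_iff.1 hx
    obtain ⟨h1, h2⟩ := nodup_of_isReducedExpr hw hall hw'
    rw [Q.coxeterElement_eq h1 h2 had, hw'.1]
  · rintro rfl
    obtain ⟨w, hw, hall, had⟩ := Q.exists_listing
    rw [Q.coxeterElement_eq hw hall had]
    exact ⟨isCoxeterElement_iff.2 ⟨w, hw, hall, rfl⟩, w,
      (isReducedExpr_iff b).2 ⟨rfl, posWord_of_nodup b hw⟩, had⟩

theorem DynkinQuiver.isAdapted_of_isReducedExpr (Q : DynkinQuiver b) {w : List b.support}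
    (hw : IsReducedExpr b w Q.coxeterElement) :
    ∃ hw : Q.IsAdapted w, ∀ i, (Q.reflectWord w hw).height i = Q.height i - 2 := by
  classical
  obtain ⟨v, hv, hall, had⟩ := Q.exists_listing
  rw [Q.coxeterElement_eq hv hall had] at hw
  obtain ⟨h1, h2⟩ := nodup_of_isReducedExpr hv hall hw
  have h3 := eqvGen_swap_of_wordProd_eq b hv (perm_of_nodup hv hall h1 h2) hw.1.symm
  have h4 : Q.IsAdapted w :=
    (Q.isAdapted_iff _).2 ((eqvGen_swap_adaptedTo h3).1 ((Q.isAdapted_iff _).1 had))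
  exact ⟨h4, fun i => by rw [Q.height_reflectWord, lower_of_nodup h1 h2]⟩

/-- Adapted reduced expressions share letter multiplicities, hence are related by exchanges, and
exchanges preserve both properties. Here `CommStep b` unfolds to `Swap (dynkinGraph b)`. -/
theorem DynkinQuiver.adaptedClass_eq_of_mem {Q : DynkinQuiver b} {w : List b.support}
    (hw : w ∈ Q.adaptedClass) : Q.adaptedClass = commutationClass b w := by
  classical
  ext v
  have hw2 := (Q.isAdapted_iff w).1 hw.2
  constructor
  · rintro ⟨h1, h2⟩
    have h2 := (Q.isAdapted_iff v).1 h2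
    exact eqvGen_swap_of_perm hw2 h2 (perm_of_adaptedTo_of_isReducedExpr hw.1 h1 hw2 h2)
  · intro h
    exact ⟨isReducedExpr_of_eqvGen h hw.1, (Q.isAdapted_iff v).2 ((eqvGen_swap_adaptedTo h).1 hw2)⟩

variable [P.IsIrreducible]

theorem DynkinQuiver.adaptedClass_nonempty (Q : DynkinQuiver b) : Q.adaptedClass.Nonempty := by
  classical
  obtain ⟨w, hw, had, -⟩ := Q.isHeight.exists_isBalanced
  exact ⟨w, hw, (Q.isAdapted_iff w).2 had⟩

theorem DynkinQuiver.height_reflectWord_longestElement (Q : DynkinQuiver b) {w : List b.support}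
    (hw : Q.IsAdapted w) (hred : IsReducedExpr b w (longestElement b)) (i : b.support) :
    (Q.reflectWord w hw).height i = Q.height (star b i) - coxeterNumber b := by
  classical
  rw [Q.height_reflectWord]
  exact (Q.isHeight.isBalanced hred ((Q.isAdapted_iff w).1 hw)).2.2 i

theorem DynkinQuiver.rotate_mem_adaptedClass (Q : DynkinQuiver b) {i : b.support}
    {w : List b.support} (hi : Q.IsSource i) (hw : Q.IsAdapted (i :: w))
    (hred : IsReducedExpr b (i :: w) (longestElement b)) :
    w ++ [star b i] ∈ (Q.reflect i hi).adaptedClass := by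
  classical
  have h := (Q.isHeight.isBalanced hred ((Q.isAdapted_iff _).1 hw)).rotate
  refine ⟨h.1, (DynkinQuiver.isAdapted_iff _ _).2 ?_⟩
  rw [Q.height_reflect]
  exact h.2.1

theorem DynkinQuiver.reflStep_reflect (Q : DynkinQuiver b) (i : b.support) (hi : Q.IsSource i) :
    ReflStep b Q.adaptedClass (Q.reflect i hi).adaptedClass := by
  classical
  obtain ⟨w, hw⟩ := Q.isHeight.exists_isBalanced
  obtain ⟨w', hred, had, -⟩ := hw.exists_cons hi
  have had := (Q.isAdapted_iff _).2 had
  exact ⟨i, w', hred, adaptedClass_eq_of_mem ⟨hred, had⟩,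
    adaptedClass_eq_of_mem (Q.rotate_mem_adaptedClass hi had hred)⟩

theorem DynkinQuiver.reflEquiv (Q Q' : DynkinQuiver b) :
    ReflEquiv b Q.adaptedClass Q'.adaptedClass := by
  classical
  refine height_induction (dynkinGraph_connected b)
    (p := fun ξ => ∀ R : DynkinQuiver b, R.height = ξ → ReflEquiv b Q.adaptedClass R.adaptedClass)
    ?_ ?_ Q.isHeight Q'.isHeight ?_ Q' rfl
  · intro ξ c h R hR
    let R' : DynkinQuiver b := ⟨ξ, fun i j hij => by
      have := R.isHeight i j hij
      rwa [hR, add_sub_add_right_eq_sub] at this⟩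
    rw [adaptedClass_congr (Q' := R') (k := c) fun i => congrFun hR i]
    exact h R' rfl
  · intro ξ i hξ hi h R hR
    let R' : DynkinQuiver b := ⟨ξ, hξ⟩
    have hi' : R'.IsSource i := hi
    have : R = R'.reflect i hi' := by
      have h2 := R'.height_reflect i hi'
      cases R
      cases hc : R'.reflect i hi'
      simp_all [R']
    rw [this]
    exact (h R' rfl).trans _ _ _ (.rel _ _ (R'.reflStep_reflect i hi'))
  · intro R hR
    rw [show R.adaptedClass = Q.adaptedClass from
      adaptedClass_congr (k := 0) fun i => by rw [hR, add_zero]]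
    exact .refl _

/-- Every vertex occurs in a word for `w_0`, so one common adapted word fixes the orientation of
every edge. -/
theorem DynkinQuiver.exists_height_eq (Q Q' : DynkinQuiver b)
    (h : Q.adaptedClass = Q'.adaptedClass) : ∃ k : ℤ, ∀ i, Q.height i = Q'.height i + k := by
  classical
  obtain ⟨w, hw⟩ := Q.adaptedClass_nonempty
  have hw' := h ▸ hw
  exact exists_eq_add_const (dynkinGraph_connected b) fun i j hij =>
    sub_eq_sub_of_adaptedTo Q.isHeight Q'.isHeight ((Q.isAdapted_iff w).1 hw.2)
      ((Q'.isAdapted_iff w).1 hw'.2) hij (mem_of_isReducedExpr_longestElement hw.1 i)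

/-- Undoing a reflection of an adapted class gives an adapted class. -/
theorem DynkinQuiver.exists_reflect_eq (Q : DynkinQuiver b) {i : b.support} {w : List b.support}
    (hred : IsReducedExpr b (i :: w) (longestElement b)) (h : w ++ [star b i] ∈ Q.adaptedClass) :
    ∃ R : DynkinQuiver b, i :: w ∈ R.adaptedClass := by
  classical
  have hQ := Q.isHeight.isBalanced h.1 ((Q.isAdapted_iff _).1 h.2)
  obtain ⟨-, had, hlow⟩ := hQ
  rw [adaptedTo_append] at had
  -- Balance gives the heights after the last letter `i^*`; adding back its two units gives those
  -- before it fired. That `i^*` was then a source means that `i` is a sink of `Q`.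
  have hsink : ∀ j, (dynkinGraph b).Adj i j → Q.height i < Q.height j := by
    intro j hij
    have h1 := had.2.1 (star b j) ((adj_star b i j).2 hij)
    have h0 := Q.isHeight.lower_of_adaptedTo had.1 _ _ ((adj_star b i j).2 hij)
    have hne : star b i ≠ star b j := fun h => hij.ne ((star_bijective b).injective h)
    have h2 : lower Q.height w (star b i) - 2 = Q.height i - coxeterNumber b := by
      rw [← lower_singleton_same, ← lower_append, hlow, star_star]
    have h3 : lower Q.height w (star b j) = Q.height j - coxeterNumber b := by
      rw [← lower_singleton_of_ne (lower Q.height w) hne, ← lower_append, hlow, star_star]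
    rw [abs_eq one_pos.le] at h0
    omega
  -- Raising the sink `i` by two produces the height function whose firing at `i` gives back `Q`.
  let ξ : b.support → ℤ := fun j => Q.height j + if i = j then 2 else 0
  have hξ : IsHeight (dynkinGraph b) ξ := by
    intro j k hjk
    have h4 := Q.isHeight j k hjk
    simp only [ξ]
    by_cases h1 : i = j
    · subst h1
      have := hsink k hjk
      rw [if_pos rfl, if_neg hjk.ne]
      rw [abs_of_neg (by omega)] at h4
      rw [abs_of_pos (by omega)]
      omega
    by_cases h2 : i = k
    · subst h2
      have := hsink j hjk.symm
      rw [if_pos rfl, if_neg h1]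
      rw [abs_of_pos (by omega)] at h4
      rw [abs_of_neg (by omega)]
      omega
    rwa [if_neg h1, if_neg h2, add_zero, add_zero]
  have hlow' : lower ξ [i] = Q.height := by
    ext j
    by_cases h1 : i = j
    · subst h1
      rw [lower_singleton_same]
      simp [ξ]
    · rw [lower_singleton_of_ne _ h1]
      simp [ξ, h1]
  refine ⟨⟨ξ, hξ⟩, hred, (DynkinQuiver.isAdapted_iff _ _).2 ⟨fun j hij => ?_, ?_⟩⟩
  · have := hsink j hij
    have h4 := Q.isHeight i j hij
    rw [abs_eq one_pos.le] at h4
    simp only [ξ, if_neg hij.ne, if_true]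
    omega
  · change AdaptedTo _ (lower ξ [i]) w
    rw [hlow']
    exact had.1

/-- Both directions are needed because the generated equivalence also traverses steps backwards. -/
theorem ReflStep.mem_range_iff {c c' : Set (List b.support)} (h : ReflStep b c c') :
    c ∈ Set.range (DynkinQuiver.adaptedClass (b := b)) ↔
      c' ∈ Set.range (DynkinQuiver.adaptedClass (b := b)) := by
  obtain ⟨i, w, hred, rfl, rfl⟩ := h
  constructor
  · rintro ⟨Q, hQ⟩
    have h1 : i :: w ∈ Q.adaptedClass := hQ ▸ self_mem_commutationClass _
    exact ⟨Q.reflect i h1.2.fst, DynkinQuiver.adaptedClass_eq_of_mem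
      (Q.rotate_mem_adaptedClass h1.2.fst h1.2 hred)⟩
  · rintro ⟨Q, hQ⟩
    obtain ⟨R, hR⟩ := Q.exists_reflect_eq hred (hQ ▸ self_mem_commutationClass _)
    exact ⟨R, DynkinQuiver.adaptedClass_eq_of_mem hR⟩

theorem ReflEquiv.mem_range_iff {c c' : Set (List b.support)} (h : ReflEquiv b c c') :
    c ∈ Set.range (DynkinQuiver.adaptedClass (b := b)) ↔
      c' ∈ Set.range (DynkinQuiver.adaptedClass (b := b)) := by
  induction h with
  | rel _ _ h => exact h.mem_range_iff
  | refl _ => rfl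
  | symm _ _ _ ih => exact ih.symm
  | trans _ _ _ _ _ ih1 ih2 => exact ih1.trans ih2

variable (b) in
theorem isRClusterPoint_range :
    IsRClusterPoint b (Set.range (DynkinQuiver.adaptedClass (b := b))) := by
  obtain ⟨ξ, hξ⟩ := exists_isHeight b
  let Q : DynkinQuiver b := ⟨ξ, hξ⟩
  obtain ⟨w, hw⟩ := Q.adaptedClass_nonempty
  have hQ := DynkinQuiver.adaptedClass_eq_of_mem hw
  refine ⟨w, hw.1, ?_⟩
  rw [← hQ]
  ext c
  constructor
  · rintro ⟨R, rfl⟩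
    obtain ⟨w', hw'⟩ := R.adaptedClass_nonempty
    exact ⟨⟨w', hw'.1, DynkinQuiver.adaptedClass_eq_of_mem hw'⟩, R.reflEquiv Q⟩
  · rintro ⟨-, h⟩
    exact (ReflEquiv.mem_range_iff h).2 ⟨Q, rfl⟩

variable (b) in
theorem ncard_range_adaptedClass :
    (Set.range (DynkinQuiver.adaptedClass (b := b))).ncard = 2 ^ (b.support.card - 1) := by
  classical
  have hG := dynkinGraph_connected b
  have := hG.nonempty
  obtain ⟨r⟩ := hG.nonempty
  obtain ⟨p, d, hd, hp, hedge⟩ := exists_parent hG (ncard_edgeSet_lt b) r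
  -- A sign for each non-root vertex orients the edge to its parent. Normalizing the height to `0`
  -- at `r` gives one representative of each height function modulo constants.
  let sgn : ({v : b.support // v ≠ r} → Bool) → b.support → ℤ := fun ε v =>
    if h : v ≠ r then (if ε ⟨v, h⟩ then 1 else -1) else 0
  have hsgn : ∀ ε (v : b.support) (h : v ≠ r), sgn ε v = if ε ⟨v, h⟩ then 1 else -1 :=
    fun ε v h => dif_pos h
  choose ξ hξr hξ using fun ε => exists_fun_of_parent hd (sgn ε)
  have hh : ∀ ε, IsHeight (dynkinGraph b) (ξ ε) := by
    intro ε v v' h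
    rcases hedge v v' h with ⟨h1, rfl⟩ | ⟨h1, rfl⟩
    · rw [hξ ε v h1, hsgn ε v h1]; split_ifs <;> simp
    · rw [hξ ε v' h1, hsgn ε v' h1]; split_ifs <;> simp
  let F : ({v : b.support // v ≠ r} → Bool) → Set (List b.support) := fun ε =>
    (⟨ξ ε, hh ε⟩ : DynkinQuiver b).adaptedClass
  have hF : Function.Injective F := by
    intro ε ε' h
    obtain ⟨k, hk⟩ := DynkinQuiver.exists_height_eq _ _ h
    ext ⟨v, hv⟩
    have h1 := hξ ε v hv
    have h2 := hξ ε' v hv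
    have h3 := hk v
    have h4 := hk (p v)
    simp only at h3 h4
    have h5 : sgn ε v = sgn ε' v := by omega
    rw [hsgn ε v hv, hsgn ε' v hv] at h5
    by_cases e : ε ⟨v, hv⟩ <;> by_cases e' : ε' ⟨v, hv⟩ <;> simp_all
  have hrange : Set.range (DynkinQuiver.adaptedClass (b := b)) = Set.range F := by
    ext c
    constructor
    · rintro ⟨Q, rfl⟩
      let ε : {v : b.support // v ≠ r} → Bool := fun v => Q.height (p v) < Q.height v
      refine ⟨ε, ?_⟩
      obtain ⟨k, hk⟩ := exists_eq_add_const hG (ξ := ξ ε) (ξ' := Q.height) fun v v' h => by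
        have key : ∀ v, v ≠ r → ξ ε v - ξ ε (p v) = Q.height v - Q.height (p v) := by
          intro v hv
          rw [hξ ε v hv, hsgn ε v hv]
          have h1 := Q.isHeight _ _ (hp v hv)
          rw [abs_eq one_pos.le] at h1
          simp only [ε, decide_eq_true_eq]
          split_ifs <;> omega
        rcases hedge v v' h with ⟨h1, rfl⟩ | ⟨h1, rfl⟩
        · exact key v h1
        · have := key v' h1
          omega
      exact DynkinQuiver.adaptedClass_congr hk
    · rintro ⟨ε, rfl⟩
      exact ⟨_, rfl⟩
  rw [hrange, ← Set.image_univ, Set.ncard_image_of_injective _ hF, Set.ncard_univ,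
    Nat.card_eq_fintype_card, Fintype.card_fun, Fintype.card_bool, Fintype.card_subtype_compl,
    Fintype.card_coe, Fintype.card_subtype_eq]

end Assembly

end DynkinQuivers

theorem mainTheorem4 {ι M N : Type*} [Finite ι] [AddCommGroup M] [Module ℝ M] [AddCommGroup N]
    [Module ℝ N] (P : RootPairing ι ℝ M N) [P.IsRootSystem] [P.IsCrystallographic] [P.IsReduced]
    [P.IsIrreducible] (b : P.Base) :
    -- `i ↦ i^*` is the map with `w_0 α_i = -α_{i^*}`
    (∀ i, DynkinQuivers.longestElement b • DynkinQuivers.simpleRoot b i =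
      -DynkinQuivers.simpleRoot b (DynkinQuivers.star b i)) ∧
    (∃ τ : DynkinQuivers.DynkinQuiver b → P.weylGroup,
      -- (i) `τ Q` is the unique Coxeter element with a `Q`-adapted reduced expression
      (∀ Q x, (DynkinQuivers.IsCoxeterElement b x ∧
          ∃ w, DynkinQuivers.IsReducedExpr b w x ∧ Q.IsAdapted w) ↔ x = τ Q) ∧
      -- (ii)
      (∀ Q i (hi : Q.IsSource i),
        DynkinQuivers.s b i * τ Q * DynkinQuivers.s b i = τ (Q.reflect i hi)) ∧
      (∀ Q, orderOf (τ Q) = DynkinQuivers.coxeterNumber b) ∧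
      (DynkinQuivers.coxeterNumber b : ℚ) =
        2 * (DynkinQuivers.numPosRoots b : ℚ) / (b.support.card : ℚ) ∧
      -- (iii)
      (∀ Q w, DynkinQuivers.IsReducedExpr b w (τ Q) →
        ∃ hw : Q.IsAdapted w, ∀ i, (Q.reflectWord w hw).height i = Q.height i - 2)) ∧
    -- (iv) the `Q`-adapted reduced expressions of `w_0` form one (non-empty) commutation class
    (∀ Q : DynkinQuivers.DynkinQuiver b, ∃ w ∈ Q.adaptedClass,
      Q.adaptedClass = DynkinQuivers.commutationClass b w) ∧
    -- (v)
    (∀ (Q : DynkinQuivers.DynkinQuiver b) (w : List b.support) (hw : Q.IsAdapted w),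
      DynkinQuivers.IsReducedExpr b w (DynkinQuivers.longestElement b) →
        ∀ i, (Q.reflectWord w hw).height i =
          Q.height (DynkinQuivers.star b i) - DynkinQuivers.coxeterNumber b) ∧
    (∀ (Q : DynkinQuivers.DynkinQuiver b) (i : b.support) (w : List b.support)
      (hw : Q.IsAdapted (i :: w)),
      DynkinQuivers.IsReducedExpr b (i :: w) (DynkinQuivers.longestElement b) →
        w ++ [DynkinQuivers.star b i] ∈ (Q.reflect i hw.fst).adaptedClass) ∧
    -- (vi)
    (∀ Q Q' : DynkinQuivers.DynkinQuiver b,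
      DynkinQuivers.ReflEquiv b Q.adaptedClass Q'.adaptedClass ∧
      (Q.adaptedClass = Q'.adaptedClass → ∃ k : ℤ, ∀ i, Q.height i = Q'.height i + k)) ∧
    -- (vii)
    DynkinQuivers.IsRClusterPoint b
      (Set.range (DynkinQuivers.DynkinQuiver.adaptedClass (b := b))) ∧
    (Set.range (DynkinQuivers.DynkinQuiver.adaptedClass (b := b))).ncard =
      2 ^ (b.support.card - 1) := by
  refine ⟨DynkinQuivers.longestElement_smul_simpleRoot b,
    ⟨DynkinQuivers.DynkinQuiver.coxeterElement, fun Q x => Q.eq_coxeterElement_iff x,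
      fun Q i hi => Q.coxeterElement_reflect i hi, fun Q => ?_, ?_,
      fun Q w hw => Q.isAdapted_of_isReducedExpr hw⟩,
    fun Q => ?_, fun Q w hw hred i => Q.height_reflectWord_longestElement hw hred i,
    fun Q i w hw hred => Q.rotate_mem_adaptedClass hw.fst hw hred,
    fun Q Q' => ⟨Q.reflEquiv Q', Q.exists_height_eq Q'⟩,
    DynkinQuivers.isRClusterPoint_range b, DynkinQuivers.ncard_range_adaptedClass b⟩
  · obtain ⟨w, hw, hall, had⟩ := Q.exists_listing
    rw [Q.coxeterElement_eq hw hall had, DynkinQuivers.orderOf_wordProd_of_nodup b hw hall]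
  · have hne : (b.support.card : ℚ) ≠ 0 := by
      obtain ⟨i⟩ := (DynkinQuivers.dynkinGraph_connected b).nonempty
      exact_mod_cast (Finset.card_pos.2 ⟨i.1, i.2⟩).ne'
    rw [eq_div_iff hne]
    exact_mod_cast DynkinQuivers.coxeterNumber_mul_card b
  · obtain ⟨w, hw⟩ := Q.adaptedClass_nonempty
    exact ⟨w, hw, DynkinQuivers.DynkinQuiver.adaptedClass_eq_of_mem hw⟩
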